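/- For a finite simple undirected graph $G=(V,E)$ with $n=|V|$ and $m=|E|$, write $\triangle(v)$ for the number of triangles containing the vertex $v$, $\triangle(G)$ for the number of triangles of $G$, $N(v)$ for the neighbourhood of $v$, $N_\triangle(v)=\{u\in N(v) : N(u)\cap N(v)\neq\emptyset\}$ and $N^+_\triangle(v)=\{v\}\cup N_\triangle(v)$. If $\triangle(G)>0$, the triangle centrality of $v$ is $$TC(v)=\frac{\frac13\sum_{u\in N^+_\triangle(v)}\triangle(u)+\sum_{w\in N(v)\setminus N_\triangle(v)}\triangle(w)}{\triangle(G)}.$$ A CREW PRAM consists of synchronous processors $0,1,\dots,P-1$ that all run the same finite program on a shared memory. Each processor has its own local registers and program counter and knows its own index. In one time step each processor executes one instruction (loading a constant; addition, truncated subtraction, multiplication or integer division of registers; reading or writing one shared cell at an address held in a register; an unconditional jump, or a jump conditional on comparing registers). Reads precede writes in each step. A cell may be read by any number of processors, but written by at most one processor, in a step. Cells and registers hold natural numbers. The graph, with $V=\{0,\dots,n-1\}$, is given by $n$, $m$ and its adjacency arrays (the arrays of offsets and of neighbours, the neighbours of each vertex being listed in arbitrary order); all other cells are initially $0$. **Theorem.**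 Triangle centrality can be computed for all vertices of a simple undirected graph on a CREW PRAM in $O(\log n)$ time using $O(m\sqrt m)$ processors. That is, there are one program and constants $C\in\mathbb R$, $K,w\in\mathbb N$ such that, for every finite simple undirected graph $G$ and every such representation of $G$ in memory, the program run by $P=K\,m\lfloor\sqrt m\rfloor$ processors never violates the exclusive-write rule, keeps all cells and registers below $(n+2)^w$ (words of $O(\log n)$ bits), and brings all processors to a halt within $C\log n$ steps. If $\triangle(G)>0$, then on halting the memory, from its first cell after the input, holds a positive integer $D$ followed by integers $N_0,\dots,N_{n-1}$ with $TC(v)=N_v/D$ for every vertex $v$. -/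

import Mathlib

/-! ## Triangle centrality of a finite simple graph -/

namespace TriangleCentrality

variable {V : Type*} [Fintype V] [DecidableEq V]

/-- The number of triangles of `G`. -/
def triangles (G : SimpleGraph V) [DecidableRel G.Adj] : ℕ :=
  (G.cliqueFinset 3).card

/-- The number of triangles of `G` that contain the vertex `v`. -/
def trianglesAt (G : SimpleGraph V) [DecidableRel G.Adj] (v : V) : ℕ :=
  ((G.cliqueFinset 3).filter (fun s => v ∈ s)).card

/-- The triangle neighbourhood of `v`: the neighbours of `v` that share a neighbour with `v`. -/
def triangleNeighbors (G : SimpleGraph V) [DecidableRel G.Adj] (v : V) : Finset V :=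
  (G.neighborFinset v).filter (fun u => (G.neighborFinset u ∩ G.neighborFinset v).Nonempty)

/-- The triangle centrality of `v` (only meaningful when `G` has a triangle). -/
def TC (G : SimpleGraph V) [DecidableRel G.Adj] (v : V) : ℚ :=
  ((1 / 3 : ℚ) * ∑ u ∈ insert v (triangleNeighbors G v), (trianglesAt G u : ℚ)
    + ∑ w ∈ G.neighborFinset v \ triangleNeighbors G v, (trianglesAt G w : ℚ))
  / (triangles G : ℚ)

end TriangleCentrality

/-! ## Synchronous parallel random access machines

All processors run the same program in lock-step, one instruction per time step, on a shared
memory of cells holding natural numbers. Each processor has its own program counter and its own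
local registers. In every step all reads take place before all writes. -/

namespace PRAM

/-- The instructions. The arguments `d s t` are register names; `l` is a program position. -/
inductive Instr : Type
  /-- `reg d := c` -/
  | const (d c : ℕ)
  /-- `reg d := reg s + reg t` -/
  | add (d s t : ℕ)
  /-- `reg d := reg s - reg t`, truncated at zero -/
  | sub (d s t : ℕ)
  /-- `reg d := reg s * reg t` -/
  | mul (d s t : ℕ)
  /-- `reg d := ⌊reg s / reg t⌋`, zero if `reg t` is zero -/
  | div (d s t : ℕ)
  /-- read from the shared memory: `reg d := mem (reg s)` -/
  | load (d s : ℕ)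
  /-- write to the shared memory: `mem (reg s) := reg t` -/
  | store (s t : ℕ)
  /-- continue at position `l` -/
  | jump (l : ℕ)
  /-- continue at position `l` if `reg s = 0` -/
  | jumpZero (s l : ℕ)
  /-- continue at position `l` if `reg s < reg t` -/
  | jumpLt (s t l : ℕ)

/-- The local state of one processor. -/
structure Proc : Type where
  pc : ℕ
  reg : ℕ → ℕ

/-- Put `x` into register `d` and go on to the next instruction. -/
def Proc.set (s : Proc) (d x : ℕ) : Proc :=
  ⟨s.pc + 1, Function.update s.reg d x⟩

/-- The local effect of an instruction; `mem` is the shared memory at the start of the step. -/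
def Instr.exec (mem : ℕ → ℕ) (p : Proc) : Instr → Proc
  | .const d c => p.set d c
  | .add d s t => p.set d (p.reg s + p.reg t)
  | .sub d s t => p.set d (p.reg s - p.reg t)
  | .mul d s t => p.set d (p.reg s * p.reg t)
  | .div d s t => p.set d (p.reg s / p.reg t)
  | .load d s => p.set d (mem (p.reg s))
  | .store _ _ => ⟨p.pc + 1, p.reg⟩
  | .jump l => ⟨l, p.reg⟩
  | .jumpZero s l => ⟨if p.reg s = 0 then l else p.pc + 1, p.reg⟩
  | .jumpLt s t l => ⟨if p.reg s < p.reg t then l else p.pc + 1, p.reg⟩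

/-- A processor has halted when its program counter is outside the program. -/
def Proc.Halted (prog : List Instr) (p : Proc) : Prop :=
  prog.length ≤ p.pc

/-- One step of one processor; a halted processor stays as it is. -/
def Proc.step (prog : List Instr) (mem : ℕ → ℕ) (p : Proc) : Proc :=
  match prog[p.pc]? with
  | some i => i.exec mem p
  | none => p

/-- The write access (address, value) that a processor makes in its next step, if any. -/
def Proc.write (prog : List Instr) (p : Proc) : Option (ℕ × ℕ) :=
  match prog[p.pc]? with
  | some (.store s t) => some (p.reg s, p.reg t)
  | _ => none

/-- A global configuration of a machine with `P` processors. -/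
structure Config (P : ℕ) : Type where
  proc : Fin P → Proc
  mem : ℕ → ℕ

/-- The starting configuration on the memory `M`: each processor has its own index in register
`0`, and all its other registers hold zero. -/
def Config.init (P : ℕ) (M : ℕ → ℕ) : Config P where
  proc p := ⟨0, fun r => if r = 0 then (p : ℕ) else 0⟩
  mem := M

/-- The shared memory after one step. Should several processors write to the same address, the
one of least index succeeds; this never happens in an exclusive-write computation. -/
def Config.nextMem {P : ℕ} (prog : List Instr) (c : Config P) (a : ℕ) : ℕ :=
  ((List.finRange P).findSome? fun p =>
    match (c.proc p).write prog with
    | some (b, x) => if b = a then some x else none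
    | none => none).getD (c.mem a)

/-- One synchronous step of all processors. -/
def Config.step {P : ℕ} (prog : List Instr) (c : Config P) : Config P where
  proc p := (c.proc p).step prog c.mem
  mem := c.nextMem prog

/-- The configuration after `t` steps of `P` processors running `prog` on the memory `M`. -/
def run (prog : List Instr) (P : ℕ) (M : ℕ → ℕ) (t : ℕ) : Config P :=
  (Config.step prog)^[t] (Config.init P M)

/-- In the next step no memory cell is written to by two different processors
(cells may be read by any number of processors). -/
def Config.ExclusiveWrite {P : ℕ} (prog : List Instr) (c : Config P) : Prop :=
  ∀ (p q : Fin P) (a x y : ℕ),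
    (c.proc p).write prog = some (a, x) → (c.proc q).write prog = some (a, y) → p = q

/-- All processors have halted. -/
def Config.Halted {P : ℕ} (prog : List Instr) (c : Config P) : Prop :=
  ∀ p, (c.proc p).Halted prog

/-- All memory cells and all registers hold numbers below `B`. -/
def Config.Below {P : ℕ} (B : ℕ) (c : Config P) : Prop :=
  (∀ a, c.mem a < B) ∧ ∀ p r, (c.proc p).reg r < B

/-! ## Graphs in memory -/

/-- The memory `M` holds the graph `G` as adjacency arrays. With `n` vertices and `m` edges:
cell `0` holds `n`, cell `1` holds `m`, cells `2, …, n + 2` hold the offsets of the adjacency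
arrays (the last of them is `2 * m`), and from cell `n + 3` on there are, one after the other,
the adjacency arrays of the vertices `0, …, n - 1`, each listing the neighbours in any order. All
other cells hold zero. -/
structure HoldsGraph {n : ℕ} (G : SimpleGraph (Fin n)) [DecidableRel G.Adj] (M : ℕ → ℕ) :
    Prop where
  numVertices : M 0 = n
  numEdges : M 1 = G.edgeFinset.card
  offset_zero : M 2 = 0
  offset_succ : ∀ v : Fin n, M (2 + ((v : ℕ) + 1)) = M (2 + (v : ℕ)) + G.degree v
  /-- The `G.degree v` entries of the adjacency array of `v` are exactly the neighbours of `v`;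
  as there are `G.degree v` of these, there is no repetition. -/
  neighbors : ∀ v : Fin n,
    (Finset.range (G.degree v)).image (fun i => M (n + 3 + M (2 + (v : ℕ)) + i)) =
      (G.neighborFinset v).image (fun u : Fin n => (u : ℕ))
  rest : ∀ a, n + 3 + 2 * G.edgeFinset.card ≤ a → M a = 0

/-- The memory `M` gives the rational numbers `f 0, …, f (n - 1)` as fractions with a common
denominator: the (nonzero) denominator is in cell `b`, and the numerator of `f v` is in cell
`b + 1 + v`. -/
def HoldsFractions {n : ℕ} (f : Fin n → ℚ) (b : ℕ) (M : ℕ → ℕ) : Prop :=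
  M b ≠ 0 ∧ ∀ v : Fin n, f v = (M (b + 1 + (v : ℕ)) : ℚ) / (M b : ℚ)

end PRAM

namespace PRAM

/-! ## A structured language for lock-step programs -/

/-! An arc is a position in the adjacency arrays; its tail is the vertex owning that array, its head
the entry stored there. Everything reduces to the numbers |N(u) ∩ N(v)| for the 2m arcs (u, v).
Summed over the arcs with tail u they give 2△(u) (`sum_common_neighbors`), summed over all arcs
6△(G), and such a number vanishes exactly when v lies outside N_△(u). Scaling by 6 makes the
centrality a quotient of integers: 2△(v) plus the sum of 2△(w) over the neighbours w, weighted by 1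
or 3, divided by 6△(G) (`TC_eq`).

To count common neighbours, take a power of two s with m ≤ s² and s ≤ 2⌊√m⌋, and an adjacency
matrix; memory starts at zero, so only its ones have to be written. If deg v < s, each neighbour of
v is tested for adjacency to u, with 2s slots per arc. If deg v ≥ s, the adjacency array of v is an
interval of at least s positions, so it contains a multiple ks, and ks < 2m ≤ 2s² gives k < 2s. It
therefore suffices to test, for every k < 2s and every arc (u, w), whether w is adjacent to the tail
of the arc ks: the sum over the arcs of u is the required number. Both tables have 4ms ≤ 8m⌊√m⌋
entries, one per processor, and prefix sums by doubling (`scan_spec`) make every sum over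
consecutive entries available in logarithmic time.

On the machine side all processors share one program counter: choices are made by arithmetic, loop
tests agree on all processors, and a processor with nothing to write writes to a scratch cell of its
own. Exclusive writing thus becomes injectivity of an address map. `Run.sound` transfers runs of the
structured language to the machine, and `Spec` records that time is linear in the number of loop
rounds and that numbers stay below a fixed power of a bound on the initial data. -/

/-- The binary operations of the machine. -/
inductive BinOp : Type
  | add | sub | mul | div

/-- The function computed by a binary operation. -/
def BinOp.fn : BinOp → ℕ → ℕ → ℕ
  | .add => (· + ·)
  | .sub => (· - ·)
  | .mul => (· * ·)
  | .div => (· / ·)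

/-- The machine instruction of a binary operation. -/
def BinOp.instr : BinOp → ℕ → ℕ → ℕ → Instr
  | .add => .add
  | .sub => .sub
  | .mul => .mul
  | .div => .div

/-- Expressions over sixteen variables, which live in the registers `0, …, 15`. -/
inductive Exp : Type
  | reg (r : Fin 16)
  | const (c : ℕ)
  | bin (op : BinOp) (a b : Exp)
  | load (a : Exp)

namespace Exp

instance : Add Exp := ⟨bin .add⟩
instance : Sub Exp := ⟨bin .sub⟩
instance : Mul Exp := ⟨bin .mul⟩
instance : Div Exp := ⟨bin .div⟩
instance (k : ℕ) : OfNat Exp k := ⟨const k⟩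

/-- The value of an expression. -/
def eval (mem : ℕ → ℕ) (V : Fin 16 → ℕ) : Exp → ℕ
  | reg r => V r
  | const c => c
  | bin op a b => op.fn (a.eval mem V) (b.eval mem V)
  | load a => mem (a.eval mem V)

/-- All intermediate results of the evaluation are below `B`. -/
def Bdd (B : ℕ) (mem : ℕ → ℕ) (V : Fin 16 → ℕ) : Exp → Prop
  | reg _ => True
  | const c => c < B
  | bin op a b => a.Bdd B mem V ∧ b.Bdd B mem V ∧ op.fn (a.eval mem V) (b.eval mem V) < B
  | load a => a.Bdd B mem V

/-- Code that puts the value of an expression into register `d`. -/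
def code : Exp → ℕ → List Instr
  | reg r, d => [.const d 0, .add d r d]
  | const c, d => [.const d c]
  | bin op a b, d => a.code d ++ (b.code (d + 1) ++ [op.instr d d (d + 1)])
  | load a, d => a.code d ++ [.load d d]

/-- The number of steps of the code of an expression. -/
def cost : Exp → ℕ
  | reg _ => 2
  | const _ => 1
  | bin _ a b => a.cost + (b.cost + 1)
  | load a => a.cost + 1

/-- An exponent that bounds the growth of numbers in the evaluation. -/
def deg : Exp → ℕ
  | reg _ => 1
  | const _ => 1
  | bin _ a b => a.deg + b.deg
  | load a => a.deg

/-- All constants in the expression are below `B`. -/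
def ConstsBelow (B : ℕ) : Exp → Prop
  | reg _ => True
  | const c => c < B
  | bin _ a b => a.ConstsBelow B ∧ b.ConstsBelow B
  | load a => a.ConstsBelow B

/-- The truth value of `a < b`. -/
def lt (a b : Exp) : Exp := 1 - (1 - (b - a))

/-- `a` if `c` is `1`, and `b` if `c` is `0`. -/
def cond (c a b : Exp) : Exp := c * a + (1 - c) * b

variable (mem : ℕ → ℕ) (V : Fin 16 → ℕ)

@[simp] theorem eval_reg (r : Fin 16) : (reg r).eval mem V = V r := rfl
@[simp] theorem eval_const (c : ℕ) : (const c).eval mem V = c := rfl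
@[simp] theorem eval_ofNat (k : ℕ) : (ofNat(k) : Exp).eval mem V = k := rfl
@[simp] theorem eval_add (a b : Exp) : (a + b).eval mem V = a.eval mem V + b.eval mem V := rfl
@[simp] theorem eval_sub (a b : Exp) : (a - b).eval mem V = a.eval mem V - b.eval mem V := rfl
@[simp] theorem eval_mul (a b : Exp) : (a * b).eval mem V = a.eval mem V * b.eval mem V := rfl
@[simp] theorem eval_div (a b : Exp) : (a / b).eval mem V = a.eval mem V / b.eval mem V := rfl
@[simp] theorem eval_load (a : Exp) : (load a).eval mem V = mem (a.eval mem V) := rfl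

-- Under truncated subtraction `1 - x` is the indicator of `x = 0`; applied twice to `b - a` it is
-- the indicator of a positive difference. Comparing without a jump keeps the processors in
-- lock-step.
@[simp] theorem eval_lt (a b : Exp) :
    (lt a b).eval mem V = if a.eval mem V < b.eval mem V then 1 else 0 := by
  simp only [lt, eval_sub, eval_ofNat]
  split_ifs <;> omega

@[simp] theorem eval_cond_lt (c d a b : Exp) :
    (cond (lt c d) a b).eval mem V =
      if c.eval mem V < d.eval mem V then a.eval mem V else b.eval mem V := by
  simp only [cond, eval_add, eval_mul, eval_sub, eval_ofNat, eval_lt]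
  split_ifs <;> simp

variable {mem V}

theorem length_code (e : Exp) (d : ℕ) : (e.code d).length = e.cost := by
  induction e generalizing d with
  | reg r => rfl
  | const c => rfl
  | bin op a b iha ihb => simp [code, cost, iha, ihb]
  | load a iha => simp [code, cost, iha]

theorem deg_pos (e : Exp) : 0 < e.deg := by
  induction e with
  | reg r => exact Nat.one_pos
  | const c => exact Nat.one_pos
  | bin op a b iha ihb => simp only [deg]; omega
  | load a iha => exact iha

theorem Bdd.mono {B B' : ℕ} (h : B ≤ B') {e : Exp} (he : e.Bdd B mem V) : e.Bdd B' mem V := by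
  induction e with
  | reg r => trivial
  | const c => exact lt_of_lt_of_le he h
  | bin op a b iha ihb => exact ⟨iha he.1, ihb he.2.1, he.2.2.trans_le h⟩
  | load a iha => exact iha he

/-- One product bound serves all four operations, so exponents simply add along an expression. -/
theorem fn_lt (op : BinOp) {x y X Y : ℕ} (hx : x < X) (hy : y < Y) (hY : 2 ≤ Y) :
    op.fn x y < X * Y := by
  have hXY : X ≤ X * Y := Nat.le_mul_of_pos_right X (by omega)
  cases op with
  | add => simp only [BinOp.fn]; nlinarith
  | sub => exact lt_of_le_of_lt (Nat.sub_le x y) (hx.trans_le hXY)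
  | mul => exact Nat.mul_lt_mul'' hx hy
  | div => exact lt_of_le_of_lt (Nat.div_le_self x y) (hx.trans_le hXY)

/-- Exponents add at each operation by `fn_lt`. A loaded value is below `b` again, but its address
passes through a register, so the exponent of the address has to be kept. -/
theorem bdd_of_below {b : ℕ} (hb : 2 ≤ b) (hmem : ∀ a, mem a < b) (hV : ∀ r, V r < b) (e : Exp)
    (he : e.ConstsBelow b) : e.Bdd (b ^ e.deg) mem V ∧ e.eval mem V < b ^ e.deg := by
  induction e with
  | reg r => exact ⟨trivial, by simpa [deg] using hV r⟩
  | const c => exact ⟨by rw [deg, pow_one]; exact he, by rw [deg, pow_one]; exact he⟩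
  | bin op a b' iha ihb =>
    obtain ⟨ha, ha'⟩ := iha he.1
    obtain ⟨hb₁, hb'⟩ := ihb he.2
    have h2 : ∀ x : Exp, 2 ≤ b ^ x.deg := fun x =>
      hb.trans (Nat.le_self_pow (deg_pos x).ne' b)
    have key : op.fn (a.eval mem V) (b'.eval mem V) < b ^ (a.deg + b'.deg) := by
      rw [pow_add]; exact fn_lt op ha' hb' (h2 b')
    have hle := fun x y : Exp => Nat.pow_le_pow_right (show 0 < b by omega)
      (Nat.le_add_right x.deg y.deg)
    exact ⟨⟨ha.mono (hle a b'), hb₁.mono (by rw [deg, add_comm]; exact hle b' a), key⟩, key⟩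
  | load a iha =>
    obtain ⟨ha, -⟩ := iha he
    exact ⟨ha, (hmem _).trans_le (Nat.le_self_pow (deg_pos a).ne' b)⟩

end Exp

/-- Lock-step statements. -/
inductive Stmt : Type
  | assign (r : Fin 16) (e : Exp)
  | store (a b : Exp)
  | seq (S S' : Stmt)
  /-- repeat the body as long as variable `r` is less than variable `r'` -/
  | loop (r r' : Fin 16) (S : Stmt)

namespace Stmt

infixr:60 " ;; " => Stmt.seq

/-- The length of the code of a statement. -/
def len : Stmt → ℕ
  | assign _ e => e.cost + 2
  | store a b => a.cost + (b.cost + 1)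
  | seq S S' => S.len + S'.len
  | loop _ _ S => S.len + 3

/-- The code of a statement, to be placed at position `pc`. -/
def code : Stmt → ℕ → List Instr
  | assign r e, _ => e.code 16 ++ [.const r 0, .add r r 16]
  | store a b, _ => a.code 16 ++ (b.code 17 ++ [.store 16 17])
  | seq S S', pc => S.code pc ++ S'.code (pc + S.len)
  | loop r r' S, pc =>
    [.jumpLt r r' (pc + 2), .jump (pc + (S.len + 3))] ++ (S.code (pc + 2) ++ [.jump pc])

theorem length_code (S : Stmt) (pc : ℕ) : (S.code pc).length = S.len := by
  induction S generalizing pc with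
  | assign r e => simp [code, len, Exp.length_code]
  | store a b => simp [code, len, Exp.length_code]
  | seq S S' ih ih' => simp [code, len, ih, ih']
  | loop r r' S ih => simp [code, len, ih]

end Stmt

/-- The state of a lock-step computation: the variables of each processor, and the memory. -/
structure St (P : ℕ) : Type where
  V : Fin P → Fin 16 → ℕ
  mem : ℕ → ℕ

variable {P : ℕ}

namespace St

/-- Set variable `r` of each processor `p` to `f p`. -/
def set (σ : St P) (r : Fin 16) (f : Fin P → ℕ) : St P :=
  ⟨fun p => Function.update (σ.V p) r (f p), σ.mem⟩

@[simp] theorem set_mem (σ : St P) (r : Fin 16) (f : Fin P → ℕ) : (σ.set r f).mem = σ.mem := rfl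

@[simp] theorem set_V (σ : St P) (r : Fin 16) (f : Fin P → ℕ) (p : Fin P) (r' : Fin 16) :
    (σ.set r f).V p r' = if r' = r then f p else σ.V p r' := by
  simp [set, Function.update_apply]

/-- All variables and all memory cells hold numbers below `b`. -/
def Below (b : ℕ) (σ : St P) : Prop :=
  (∀ a, σ.mem a < b) ∧ ∀ p r, σ.V p r < b

theorem Below.mono {b b' : ℕ} (h : b ≤ b') {σ : St P} (hσ : σ.Below b) : σ.Below b' :=
  ⟨fun a => (hσ.1 a).trans_le h, fun p r => (hσ.2 p r).trans_le h⟩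

end St

/-- The effect of an exclusive write of `val p` to `addr p` by each processor `p`. -/
def Writes (mem : ℕ → ℕ) (addr val : Fin P → ℕ) (mem' : ℕ → ℕ) : Prop :=
  (∀ p, mem' (addr p) = val p) ∧ ∀ a, (∀ p, addr p ≠ a) → mem' a = mem a

/-- `Run B S σ t σ'`: the statement `S` takes the state `σ` to the state `σ'` in `t` steps; all
numbers that occur on the way are below `B`. -/
inductive Run (B : ℕ) : Stmt → St P → ℕ → St P → Prop
  | assign (r : Fin 16) (e : Exp) (σ : St P) (h : ∀ p, e.Bdd B σ.mem (σ.V p)) :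
      Run B (.assign r e) σ (e.cost + 2) (σ.set r fun p => e.eval σ.mem (σ.V p))
  | store (a b : Exp) (σ : St P) (mem' : ℕ → ℕ) (ha : ∀ p, a.Bdd B σ.mem (σ.V p))
      (hb : ∀ p, b.Bdd B σ.mem (σ.V p)) (hinj : Function.Injective fun p => a.eval σ.mem (σ.V p))
      (hw : Writes σ.mem (fun p => a.eval σ.mem (σ.V p)) (fun p => b.eval σ.mem (σ.V p)) mem') :
      Run B (.store a b) σ (a.cost + (b.cost + 1)) ⟨σ.V, mem'⟩
  | seq {S S' : Stmt} {σ σ' σ'' : St P} {t t' : ℕ} (h : Run B S σ t σ') (h' : Run B S' σ' t' σ'') :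
      Run B (.seq S S') σ (t + t') σ''
  | loop_done (r r' : Fin 16) (S : Stmt) (σ : St P) (h : ∀ p, ¬ σ.V p r < σ.V p r') :
      Run B (.loop r r' S) σ 2 σ
  | loop_step {r r' : Fin 16} {S : Stmt} {σ σ' σ'' : St P} {t t' : ℕ}
      (h : ∀ p, σ.V p r < σ.V p r') (h' : Run B S σ t σ') (h'' : Run B (.loop r r' S) σ' t' σ'') :
      Run B (.loop r r' S) σ (1 + (t + (1 + t'))) σ''

theorem Run.mono {B B' : ℕ} (hB : B ≤ B') {S : Stmt} {σ σ' : St P} {t : ℕ} (h : Run B S σ t σ') :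
    Run B' S σ t σ' := by
  induction h with
  | assign r e σ h => exact .assign r e σ fun p => (h p).mono hB
  | store a b σ mem' ha hb hinj hw =>
    exact .store a b σ mem' (fun p => (ha p).mono hB) (fun p => (hb p).mono hB) hinj hw
  | seq _ _ ih ih' => exact .seq ih ih'
  | loop_done r r' S σ h => exact .loop_done r r' S σ h
  | loop_step h _ _ ih ih' => exact .loop_step h ih ih'

/-! ## The machine executes the compiled code correctly -/

/-- The code `l` stands at position `pc` of `prog`. -/
def CodeAt (prog : List Instr) (pc : ℕ) (l : List Instr) : Prop :=
  ∀ i, i < l.length → prog[pc + i]? = l[i]?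

theorem CodeAt.append {prog : List Instr} {pc : ℕ} {l l' : List Instr}
    (h : CodeAt prog pc (l ++ l')) : CodeAt prog pc l ∧ CodeAt prog (pc + l.length) l' := by
  refine ⟨fun i hi => ?_, fun i hi => ?_⟩
  · rw [h i (by simp; omega), List.getElem?_append_left hi]
  · rw [add_assoc, h (l.length + i) (by simpa using hi), List.getElem?_append_right (by omega)]
    simp

theorem CodeAt.head {prog : List Instr} {pc : ℕ} {i : Instr} {l : List Instr}
    (h : CodeAt prog pc (i :: l)) : prog[pc]? = some i := by
  simpa using h 0 (by simp)

theorem CodeAt.tail {prog : List Instr} {pc : ℕ} {i : Instr} {l : List Instr}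
    (h : CodeAt prog pc (i :: l)) : CodeAt prog (pc + 1) l := by
  simpa using (CodeAt.append (l := [i]) h).2

/-- The machine gets from `c` to `c'` in `t` steps, respecting the exclusive-write rule and the
bound `B` until it arrives at `c'`. -/
def Safe (prog : List Instr) (B : ℕ) (c : Config P) (t : ℕ) (c' : Config P) : Prop :=
  (Config.step prog)^[t] c = c' ∧
    ∀ k < t, ((Config.step prog)^[k] c).ExclusiveWrite prog ∧ ((Config.step prog)^[k] c).Below B

theorem Safe.trans {prog : List Instr} {B : ℕ} {c c' c'' : Config P} {t t' : ℕ}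
    (h : Safe prog B c t c') (h' : Safe prog B c' t' c'') : Safe prog B c (t + t') c'' := by
  obtain ⟨rfl, h2⟩ := h
  obtain ⟨rfl, h2'⟩ := h'
  refine ⟨by rw [add_comm, Function.iterate_add_apply], fun k hk => ?_⟩
  rcases lt_or_ge k t with hkt | hkt
  · exact h2 k hkt
  · obtain ⟨l, rfl⟩ := Nat.exists_eq_add_of_le hkt
    have := h2' l (by omega)
    rwa [← Function.iterate_add_apply, add_comm] at this

theorem Safe.one {prog : List Instr} {B : ℕ} {c : Config P} (he : c.ExclusiveWrite prog)
    (hb : c.Below B) : Safe prog B c 1 (c.step prog) := by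
  refine ⟨rfl, fun k hk => ?_⟩
  obtain rfl : k = 0 := by omega
  exact ⟨he, hb⟩

theorem write_of_getElem {prog : List Instr} {q : Proc} {i : Instr} (hi : prog[q.pc]? = some i)
    (hns : ∀ s t, i ≠ .store s t) : q.write prog = none := by
  unfold Proc.write
  rw [hi]
  cases i <;> first | rfl | exact absurd rfl (hns _ _)

theorem nextMem_of_none {prog : List Instr} {c : Config P}
    (h : ∀ p, (c.proc p).write prog = none) : c.nextMem prog = c.mem := by
  funext a
  have : (List.finRange P).findSome? (fun _ => (none : Option ℕ)) = none := by
    rw [List.findSome?_eq_none_iff]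
    exact fun p _ => rfl
  simp only [Config.nextMem, h, this, Option.getD_none]

/-- Injective addresses leave at most one writer per cell, so the tie-breaking by least index never
matters. -/
theorem nextMem_writes {prog : List Instr} {c : Config P} {addr val : Fin P → ℕ}
    (h : ∀ p, (c.proc p).write prog = some (addr p, val p)) (hinj : Function.Injective addr) :
    Writes c.mem addr val (c.nextMem prog) := by
  have key : ∀ a, c.nextMem prog a = ((List.finRange P).findSome? fun p =>
      if addr p = a then some (val p) else none).getD (c.mem a) := by
    intro a
    simp only [Config.nextMem, h]
  refine ⟨fun p => ?_, fun a ha => ?_⟩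
  · rw [key]
    cases hf : (List.finRange P).findSome?
        (fun q => if addr q = addr p then some (val q) else none) with
    | none =>
      rw [List.findSome?_eq_none_iff] at hf
      simpa using hf p (List.mem_finRange p)
    | some x =>
      obtain ⟨q, -, hq⟩ := List.exists_of_findSome?_eq_some hf
      split_ifs at hq with hqp
      obtain rfl := hinj hqp
      simpa using hq.symm
  · have : (List.finRange P).findSome?
        (fun p => if addr p = a then some (val p) else none) = none := by
      rw [List.findSome?_eq_none_iff]
      intro p _
      simp [ha p]
    rw [key, this, Option.getD_none]

theorem step_local {prog : List Instr} {c : Config P} {pc : ℕ} {i : Instr}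
    (hpc : ∀ p, (c.proc p).pc = pc) (hi : prog[pc]? = some i) (hns : ∀ s t, i ≠ .store s t) :
    c.ExclusiveWrite prog ∧ c.step prog = ⟨fun p => i.exec c.mem (c.proc p), c.mem⟩ := by
  have hw : ∀ p, (c.proc p).write prog = none := fun p =>
    write_of_getElem (by rw [hpc p, hi]) hns
  refine ⟨fun p q a x y hp => by simp [hw p] at hp, ?_⟩
  rw [Config.step, nextMem_of_none hw]
  congr 1
  funext p
  rw [Proc.step, hpc p, hi]

/-- Executing an instruction that sets a register. -/
theorem safe_set {prog : List Instr} {B : ℕ} {c : Config P} {pc : ℕ} {i : Instr} {d : ℕ}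
    {f : Fin P → ℕ} (hpc : ∀ p, (c.proc p).pc = pc) (hi : prog[pc]? = some i)
    (hns : ∀ s t, i ≠ .store s t) (hex : ∀ p, i.exec c.mem (c.proc p) = (c.proc p).set d (f p))
    (hc : c.Below B) (hf : ∀ p, f p < B) :
    ∃ c' : Config P, Safe prog B c 1 c' ∧ (∀ p, (c'.proc p).pc = pc + 1) ∧ c'.mem = c.mem ∧
      (∀ p, (c'.proc p).reg d = f p) ∧ (∀ p r, r ≠ d → (c'.proc p).reg r = (c.proc p).reg r) ∧
      c'.Below B := by
  obtain ⟨h1, h2⟩ := step_local hpc hi hns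
  refine ⟨_, Safe.one h1 hc, ?_⟩
  rw [h2]
  refine ⟨fun p => by simp [hex, Proc.set, hpc p], rfl, fun p => by simp [hex, Proc.set],
    fun p r hr => by simp [hex, Proc.set, hr], hc.1, fun p r => ?_⟩
  simp only [hex, Proc.set, Function.update_apply]
  split_ifs
  · exact hf p
  · exact hc.2 p r

/-- Executing a jump. -/
theorem safe_jump {prog : List Instr} {B : ℕ} {c : Config P} {pc : ℕ} {i : Instr} {l : ℕ}
    (hpc : ∀ p, (c.proc p).pc = pc) (hi : prog[pc]? = some i)
    (hns : ∀ s t, i ≠ .store s t) (hex : ∀ p, i.exec c.mem (c.proc p) = ⟨l, (c.proc p).reg⟩)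
    (hc : c.Below B) :
    ∃ c' : Config P, Safe prog B c 1 c' ∧ (∀ p, (c'.proc p).pc = l) ∧ c'.mem = c.mem ∧
      (∀ p, (c'.proc p).reg = (c.proc p).reg) ∧ c'.Below B := by
  obtain ⟨h1, h2⟩ := step_local hpc hi hns
  refine ⟨_, Safe.one h1 hc, ?_⟩
  rw [h2]
  refine ⟨fun p => by simp [hex], rfl, fun p => by simp [hex], hc.1, fun p r => ?_⟩
  simpa only [hex] using hc.2 p r

theorem BinOp.exec_instr (op : BinOp) (mem : ℕ → ℕ) (q : Proc) (d s t : ℕ) :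
    (op.instr d s t).exec mem q = q.set d (op.fn (q.reg s) (q.reg t)) := by
  cases op <;> rfl

theorem BinOp.instr_ne (op : BinOp) (d s t s' t' : ℕ) : op.instr d s t ≠ .store s' t' := by
  cases op <;> exact nofun

/-- The registers from `d` on act as a stack: the left operand waits in `d` while the right one is
evaluated from `d + 1` upwards. As `d` is at least 16, the variables survive. -/
theorem Exp.safe {prog : List Instr} {B : ℕ} (e : Exp) (d : ℕ) (hd : 16 ≤ d) (pc : ℕ)
    (c : Config P) (V : Fin P → Fin 16 → ℕ) (hpc : ∀ p, (c.proc p).pc = pc)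
    (hV : ∀ p (r : Fin 16), (c.proc p).reg r = V p r) (hcode : CodeAt prog pc (e.code d))
    (hc : c.Below B) (he : ∀ p, e.Bdd B c.mem (V p)) :
    ∃ c' : Config P, Safe prog B c e.cost c' ∧ (∀ p, (c'.proc p).pc = pc + e.cost) ∧
      c'.mem = c.mem ∧ (∀ p, (c'.proc p).reg d = e.eval c.mem (V p)) ∧
      (∀ p r, r < d → (c'.proc p).reg r = (c.proc p).reg r) ∧ c'.Below B := by
  induction e generalizing d pc c with
  | reg r =>
    rw [Exp.code] at hcode
    obtain ⟨c₁, s₁, p₁, m₁, r₁, o₁, b₁⟩ := safe_set (d := d) (f := fun _ => 0) hpc hcode.head nofun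
      (fun p => rfl) hc (fun p => Nat.zero_lt_of_lt (hc.1 0))
    -- There is no copy instruction: `d` has just been cleared, so adding it to the source copies
    -- the source.
    have hr : ∀ p, (c₁.proc p).reg r + (c₁.proc p).reg d = V p r := fun p => by
      rw [o₁ p r (by omega), r₁ p, hV, add_zero]
    obtain ⟨c₂, s₂, p₂, m₂, r₂, o₂, b₂⟩ := safe_set (d := d) (f := fun p => V p r) p₁
      hcode.tail.head nofun (fun p => by rw [← hr p]; rfl) b₁
      (fun p => by rw [← hV]; exact hc.2 p r)
    refine ⟨c₂, s₁.trans s₂, p₂, m₂.trans m₁, r₂, fun p r' hr' => ?_, b₂⟩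
    rw [o₂ p r' (by omega), o₁ p r' (by omega)]
  | const k =>
    rw [Exp.code] at hcode
    obtain ⟨c₁, s₁, p₁, m₁, r₁, o₁, b₁⟩ := safe_set (d := d) (f := fun _ => k) hpc hcode.head nofun
      (fun p => rfl) hc he
    exact ⟨c₁, s₁, p₁, m₁, r₁, fun p r' hr' => o₁ p r' (by omega), b₁⟩
  | bin op a b iha ihb =>
    rw [Exp.code] at hcode
    obtain ⟨h₁, h₂⟩ := hcode.append
    obtain ⟨h₂, h₃⟩ := h₂.append
    rw [Exp.length_code] at h₂ h₃
    rw [Exp.length_code] at h₃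
    obtain ⟨c₁, s₁, p₁, m₁, r₁, o₁, b₁⟩ := iha d hd pc c hpc hV h₁ hc fun p => (he p).1
    obtain ⟨c₂, s₂, p₂, m₂, r₂, o₂, b₂⟩ := ihb (d + 1) (by omega) _ c₁ p₁
      (fun p r => by rw [o₁ p r (by omega), hV]) h₂ b₁
      fun p => by rw [m₁]; exact (he p).2.1
    have hval : ∀ p, op.fn ((c₂.proc p).reg d) ((c₂.proc p).reg (d + 1)) =
        (Exp.bin op a b).eval c.mem (V p) := fun p => by
      rw [o₂ p d (by omega), r₁, r₂, m₁]; rfl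
    obtain ⟨c₃, s₃, p₃, m₃, r₃, o₃, b₃⟩ := safe_set (d := d)
      (f := fun p => (Exp.bin op a b).eval c.mem (V p)) p₂ h₃.head (op.instr_ne _ _ _)
      (fun p => by rw [op.exec_instr, hval]) b₂ (fun p => (he p).2.2)
    refine ⟨c₃, s₁.trans (s₂.trans s₃), fun p => by rw [p₃, Exp.cost]; omega,
      m₃.trans (m₂.trans m₁), r₃, fun p r' hr' => ?_, b₃⟩
    rw [o₃ p r' (by omega), o₂ p r' (by omega), o₁ p r' hr']
  | load a iha =>
    rw [Exp.code] at hcode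
    obtain ⟨h₁, h₂⟩ := hcode.append
    rw [Exp.length_code] at h₂
    obtain ⟨c₁, s₁, p₁, m₁, r₁, o₁, b₁⟩ := iha d hd pc c hpc hV h₁ hc he
    obtain ⟨c₃, s₃, p₃, m₃, r₃, o₃, b₃⟩ := safe_set (d := d)
      (f := fun p => (Exp.load a).eval c.mem (V p)) p₁ h₂.head nofun
      (fun p => by simp only [Instr.exec, m₁, r₁]; rfl) b₁ (fun p => hc.1 _)
    refine ⟨c₃, s₁.trans s₃, fun p => by rw [p₃, Exp.cost]; omega,
      m₃.trans m₁, r₃, fun p r' hr' => ?_, b₃⟩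
    rw [o₃ p r' (by omega), o₁ p r' hr']

/-- The configuration `c` is in the state `σ`, with all processors at position `pc`. -/
structure Config.Rep (c : Config P) (pc : ℕ) (σ : St P) : Prop where
  pc_eq : ∀ p, (c.proc p).pc = pc
  reg_eq : ∀ p (r : Fin 16), (c.proc p).reg r = σ.V p r
  mem_eq : c.mem = σ.mem

theorem safe_store {prog : List Instr} {B : ℕ} {c : Config P} {pc : ℕ} {s t : ℕ}
    {mem' : ℕ → ℕ} (hpc : ∀ p, (c.proc p).pc = pc) (hi : prog[pc]? = some (.store s t))
    (hinj : Function.Injective fun p => (c.proc p).reg s) (hc : c.Below B)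
    (hw : Writes c.mem (fun p => (c.proc p).reg s) (fun p => (c.proc p).reg t) mem') :
    ∃ c' : Config P, Safe prog B c 1 c' ∧ (∀ p, (c'.proc p).pc = pc + 1) ∧
      (∀ p, (c'.proc p).reg = (c.proc p).reg) ∧ c'.mem = mem' ∧ c'.Below B := by
  have hwr : ∀ p, (c.proc p).write prog = some ((c.proc p).reg s, (c.proc p).reg t) := fun p => by
    simp only [Proc.write, hpc p, hi]
  have hstep : ∀ p, (c.proc p).step prog c.mem = ⟨pc + 1, (c.proc p).reg⟩ := fun p => by
    simp only [Proc.step, hpc p, hi, Instr.exec]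
  -- `Writes` determines the new memory cell by cell, so `mem'` is the memory the machine produces.
  have hmem : c.nextMem prog = mem' := by
    have h := nextMem_writes hwr hinj
    funext a
    by_cases ha : ∃ p, (c.proc p).reg s = a
    · obtain ⟨p, rfl⟩ := ha
      rw [h.1 p, hw.1 p]
    · push Not at ha
      rw [h.2 a ha, hw.2 a ha]
  refine ⟨c.step prog, Safe.one (fun p q a x y hp hq => ?_) hc, fun p => ?_, fun p => ?_, hmem, ?_⟩
  · rw [hwr p] at hp
    rw [hwr q] at hq
    simp only [Option.some.injEq, Prod.mk.injEq] at hp hq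
    exact hinj (hp.1.trans hq.1.symm)
  · simp only [Config.step, hstep]
  · simp only [Config.step, hstep]
  · refine ⟨fun a => ?_, fun p r => ?_⟩
    · change c.nextMem prog a < B
      rw [hmem]
      by_cases ha : ∃ p, (c.proc p).reg s = a
      · obtain ⟨p, rfl⟩ := ha
        rw [hw.1 p]
        exact hc.2 p t
      · push Not at ha
        rw [hw.2 a ha]
        exact hc.1 a
    · simpa only [Config.step, hstep] using hc.2 p r

/-- Induction on the run. A common position for all processors can be maintained because both loop
rules demand the same outcome of the test on every processor. -/
theorem Run.sound {prog : List Instr} {B : ℕ} {S : Stmt} {σ σ' : St P} {t : ℕ}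
    (h : Run B S σ t σ') : ∀ (c : Config P) (pc : ℕ), c.Rep pc σ → CodeAt prog pc (S.code pc) →
      c.Below B → ∃ c' : Config P, Safe prog B c t c' ∧ c'.Rep (pc + S.len) σ' ∧ c'.Below B := by
  induction h with
  | assign r e σ h =>
    intro c pc hrep hcode hc
    obtain ⟨h₁, h₂⟩ := CodeAt.append hcode
    rw [Exp.length_code] at h₂
    obtain ⟨c₁, s₁, p₁, m₁, r₁, o₁, b₁⟩ := e.safe 16 le_rfl pc c σ.V hrep.pc_eq hrep.reg_eq h₁ hc
      (by rw [hrep.mem_eq]; exact h)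
    obtain ⟨c₂, s₂, p₂, m₂, r₂, o₂, b₂⟩ := safe_set (d := r) (f := fun _ => 0) p₁ h₂.head nofun
      (fun p => rfl) b₁ (fun p => Nat.zero_lt_of_lt (hc.1 0))
    have hval : ∀ p, (c₂.proc p).reg r + (c₂.proc p).reg 16 = e.eval σ.mem (σ.V p) := fun p => by
      rw [r₂, o₂ p 16 (by omega), r₁, hrep.mem_eq, zero_add]
    obtain ⟨c₃, s₃, p₃, m₃, r₃, o₃, b₃⟩ := safe_set (d := r)
      (f := fun p => e.eval σ.mem (σ.V p)) p₂ h₂.tail.head nofun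
      (fun p => by rw [← hval p]; rfl) b₂ (fun p => by
        rw [← hrep.mem_eq, ← r₁ p]; exact b₁.2 p 16)
    refine ⟨c₃, s₁.trans (s₂.trans s₃), ⟨fun p => by rw [p₃, Stmt.len]; omega, fun p r' => ?_,
      by rw [m₃, m₂, m₁, hrep.mem_eq]; rfl⟩, b₃⟩
    rw [St.set_V]
    split_ifs with hr
    · rw [hr, r₃]
    · have : (r' : ℕ) ≠ r := fun h => hr (Fin.ext h)
      rw [o₃ p r' this, o₂ p r' this, o₁ p r' (by omega), hrep.reg_eq]
  | store a b σ mem' ha hb hinj hw =>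
    intro c pc hrep hcode hc
    obtain ⟨h₁, h₂⟩ := CodeAt.append hcode
    rw [Exp.length_code] at h₂
    obtain ⟨h₂, h₃⟩ := CodeAt.append h₂
    rw [Exp.length_code] at h₃
    obtain ⟨c₁, s₁, p₁, m₁, r₁, o₁, b₁⟩ := a.safe 16 le_rfl pc c σ.V hrep.pc_eq hrep.reg_eq h₁ hc
      (by rw [hrep.mem_eq]; exact ha)
    obtain ⟨c₂, s₂, p₂, m₂, r₂, o₂, b₂⟩ := b.safe 17 (by omega) _ c₁ σ.V p₁
      (fun p r => by rw [o₁ p r (by omega), hrep.reg_eq]) h₂ b₁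
      (by rw [m₁, hrep.mem_eq]; exact hb)
    have e1 : (fun p => (c₂.proc p).reg 16) = fun p => a.eval σ.mem (σ.V p) := by
      funext p; rw [o₂ p 16 (by omega), r₁, hrep.mem_eq]
    have e2 : (fun p => (c₂.proc p).reg 17) = fun p => b.eval σ.mem (σ.V p) := by
      funext p; rw [r₂, m₁, hrep.mem_eq]
    obtain ⟨c₃, s₃, p₃, r₃, m₃, b₃⟩ := safe_store (mem' := mem') p₂ h₃.head (by rw [e1]; exact hinj)
      b₂ (by rw [e1, e2, m₂, m₁, hrep.mem_eq]; exact hw)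
    refine ⟨c₃, s₁.trans (s₂.trans s₃), ⟨fun p => by rw [p₃, Stmt.len]; omega, fun p r => ?_, m₃⟩,
      b₃⟩
    rw [r₃, o₂ p r (by omega), o₁ p r (by omega), hrep.reg_eq]
  | seq _ _ ih ih' =>
    intro c pc hrep hcode hc
    obtain ⟨h₁, h₂⟩ := CodeAt.append hcode
    rw [Stmt.length_code] at h₂
    obtain ⟨c₁, s₁, r₁, b₁⟩ := ih c pc hrep h₁ hc
    obtain ⟨c₂, s₂, r₂, b₂⟩ := ih' c₁ _ r₁ h₂ b₁
    exact ⟨c₂, s₁.trans s₂, by rw [Stmt.len, ← add_assoc]; exact r₂, b₂⟩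
  | loop_done r r' S σ h =>
    intro c pc hrep hcode hc
    obtain ⟨h₁, -⟩ := CodeAt.append hcode
    obtain ⟨c₁, s₁, p₁, m₁, r₁, b₁⟩ := safe_jump (l := pc + 1) hrep.pc_eq h₁.head nofun
      (fun p => by
        simp only [Instr.exec, hrep.reg_eq, hrep.pc_eq]
        rw [if_neg (h p)]) hc
    obtain ⟨c₂, s₂, p₂, m₂, r₂, b₂⟩ := safe_jump p₁ h₁.tail.head nofun (fun p => rfl) b₁
    exact ⟨c₂, s₁.trans s₂, ⟨p₂, fun p r => by rw [r₂, r₁, hrep.reg_eq],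
      by rw [m₂, m₁, hrep.mem_eq]⟩, b₂⟩
  | @loop_step r r' S σ σ' σ'' t t' h h' h'' ih ih' =>
    intro c pc hrep hcode hc
    obtain ⟨h₁, h₂⟩ := CodeAt.append hcode
    obtain ⟨h₂, h₃⟩ := CodeAt.append h₂
    rw [Stmt.length_code] at h₃
    obtain ⟨c₁, s₁, p₁, m₁, r₁, b₁⟩ := safe_jump (l := pc + 2) hrep.pc_eq h₁.head nofun
      (fun p => by
        simp only [Instr.exec, hrep.reg_eq, hrep.pc_eq]
        rw [if_pos (h p)]) hc
    obtain ⟨c₂, s₂, r₂, b₂⟩ := ih c₁ (pc + 2) ⟨p₁, fun p r => by rw [r₁, hrep.reg_eq],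
      by rw [m₁, hrep.mem_eq]⟩ h₂ b₁
    obtain ⟨c₃, s₃, p₃, m₃, r₃, b₃⟩ := safe_jump r₂.pc_eq h₃.head nofun (fun p => rfl) b₂
    obtain ⟨c₄, s₄, r₄, b₄⟩ := ih' c₃ pc ⟨p₃, fun p r => by rw [r₃, r₂.reg_eq],
      by rw [m₃, r₂.mem_eq]⟩ hcode b₃
    exact ⟨c₄, s₁.trans (s₂.trans (s₃.trans s₄)), r₄, b₄⟩

/-- A run of a statement from the initial state, as a complete computation of the machine. -/
theorem Run.machine {B : ℕ} {S : Stmt} {M : ℕ → ℕ} {σ : St P} {T : ℕ}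
    (h : Run B S ⟨fun p r => if r = 0 then (p : ℕ) else 0, M⟩ T σ)
    (hM : ∀ a, M a < B) (hP : P ≤ B) :
    (∀ t, (run (S.code 0) P M t).ExclusiveWrite (S.code 0)) ∧
    (∀ t, (run (S.code 0) P M t).Below B) ∧
    (run (S.code 0) P M T).Halted (S.code 0) ∧ (run (S.code 0) P M T).mem = σ.mem := by
  obtain ⟨c', ⟨hs, hsafe⟩, hrep, hb⟩ := h.sound (prog := S.code 0) (Config.init P M) 0
    ⟨fun p => rfl, fun p r => by simp only [Config.init, Fin.ext_iff, Fin.val_zero], rfl⟩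
    (fun i hi => by rw [zero_add]) ⟨hM, fun p r => by
      simp only [Config.init]
      split_ifs
      · exact p.2.trans_le hP
      · exact Nat.zero_lt_of_lt (hM 0)⟩
  have hnone : ∀ p, (S.code 0)[(c'.proc p).pc]? = none := fun p => by
    rw [hrep.pc_eq, List.getElem?_eq_none_iff, Stmt.length_code, zero_add]
  have hwr : ∀ p, (c'.proc p).write (S.code 0) = none := fun p => by
    simp only [Proc.write, hnone]
  -- A halted configuration is a fixed point, so safety up to time `T` extends to all times.
  have hfix : c'.step (S.code 0) = c' := by
    rw [Config.step, nextMem_of_none hwr]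
    have : (fun p => (c'.proc p).step (S.code 0) c'.mem) = c'.proc := by
      funext p
      simp only [Proc.step, hnone]
    rw [this]
  have hlate : ∀ k, run (S.code 0) P M (k + T) = c' := fun k => by
    rw [run, Function.iterate_add_apply, hs, Function.iterate_fixed hfix]
  have hT : run (S.code 0) P M T = c' := by simpa using hlate 0
  refine ⟨fun t => ?_, fun t => ?_, ?_, ?_⟩
  · rcases lt_or_ge t T with ht | ht
    · exact (hsafe t ht).1
    · obtain ⟨k, rfl⟩ := Nat.exists_eq_add_of_le' ht
      rw [hlate]
      exact fun p q a x y hp => absurd hp (by rw [hwr p]; exact nofun)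
  · rcases lt_or_ge t T with ht | ht
    · exact (hsafe t ht).2
    · obtain ⟨k, rfl⟩ := Nat.exists_eq_add_of_le' ht
      rw [hlate]
      exact hb
  · rw [hT]
    intro p
    rw [Proc.Halted, hrep.pc_eq, Stmt.length_code, zero_add]
  · rw [hT, hrep.mem_eq]

end PRAM

namespace PRAM

/-! ## Specifications -/

/-- All constants in the expression are below sixteen. -/
def Exp.Small : Exp → Prop
  | .reg _ => True
  | .const c => c < 16
  | .bin _ a b => a.Small ∧ b.Small
  | .load a => a.Small

theorem Exp.Small.constsBelow {b : ℕ} (hb : 16 ≤ b) {e : Exp} (he : e.Small) :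
    e.ConstsBelow b := by
  induction e with
  | reg r => trivial
  | const c => exact lt_of_lt_of_le he hb
  | bin op x y ihx ihy => exact ⟨ihx he.1, ihy he.2⟩
  | load a ih => exact ih he

namespace Exp

@[simp] theorem small_reg (r : Fin 16) : (reg r).Small := trivial
@[simp] theorem small_const (c : ℕ) : (const c).Small ↔ c < 16 := Iff.rfl
@[simp] theorem small_ofNat (k : ℕ) : (ofNat(k) : Exp).Small ↔ k < 16 := Iff.rfl
@[simp] theorem small_add (a b : Exp) : (a + b).Small ↔ a.Small ∧ b.Small := Iff.rfl
@[simp] theorem small_sub (a b : Exp) : (a - b).Small ↔ a.Small ∧ b.Small := Iff.rfl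
@[simp] theorem small_mul (a b : Exp) : (a * b).Small ↔ a.Small ∧ b.Small := Iff.rfl
@[simp] theorem small_div (a b : Exp) : (a / b).Small ↔ a.Small ∧ b.Small := Iff.rfl
@[simp] theorem small_load (a : Exp) : (load a).Small ↔ a.Small := Iff.rfl
@[simp] theorem small_lt (a b : Exp) : (lt a b).Small ↔ a.Small ∧ b.Small := by
  simp [lt, and_comm]
@[simp] theorem small_cond (c a b : Exp) : (cond c a b).Small ↔ c.Small ∧ a.Small ∧ b.Small := by
  simp [cond]; tauto

end Exp

namespace Stmt

/-- An exponent that bounds the growth of numbers in a statement. A loop is supposed to keep the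
numbers below the cube of the initial bound. -/
def deg : Stmt → ℕ
  | assign _ e => e.deg
  | store a b => a.deg + b.deg
  | seq S S' => S.deg * S'.deg
  | loop _ _ S => 3 * S.deg

/-- A bound for the number of steps, if each loop is repeated at most `L` times and there are no
nested loops. -/
def time (L : ℕ) : Stmt → ℕ
  | assign _ e => e.cost + 2
  | store a b => a.cost + (b.cost + 1)
  | seq S S' => S.time L + S'.time L
  | loop _ _ S => L * (S.time 0 + 2) + 2

theorem deg_pos (S : Stmt) : 0 < S.deg := by
  induction S with
  | assign r e => exact e.deg_pos
  | store a b => exact Nat.add_pos_left a.deg_pos _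
  | seq S S' ih ih' => exact Nat.mul_pos ih ih'
  | loop r r' S ih => exact Nat.mul_pos (by omega) ih

theorem time_le (S : Stmt) {L : ℕ} (hL : 1 ≤ L) : S.time L ≤ S.time 1 * L := by
  induction S with
  | assign r e => exact Nat.le_mul_of_pos_right _ hL
  | store a b => exact Nat.le_mul_of_pos_right _ hL
  | seq S S' ih ih' => simp only [time]; rw [add_mul]; exact Nat.add_le_add ih ih'
  | loop r r' S ih => simp only [time]; nlinarith

end Stmt

variable {P : ℕ}

/-- From the state `σ`, the statement `S` leads to a state that satisfies `Q`, with at most `L`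
repetitions of each loop, and with a polynomial growth of the numbers. -/
def Spec (L : ℕ) (S : Stmt) (σ : St P) (Q : St P → Prop) : Prop :=
  ∀ b, 16 ≤ b → σ.Below b → ∃ (σ' : St P) (t : ℕ), t ≤ S.time L ∧ Run (b ^ S.deg) S σ t σ' ∧
    σ'.Below (b ^ S.deg) ∧ Q σ'

namespace Spec

variable {L : ℕ} {σ : St P} {Q : St P → Prop}

theorem weaken {S : Stmt} {Q' : St P → Prop} (h : Spec L S σ Q') (hQ : ∀ σ', Q' σ' → Q σ') :
    Spec L S σ Q := by
  intro b hb hσ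
  obtain ⟨σ', t, h1, h2, h3, h4⟩ := h b hb hσ
  exact ⟨σ', t, h1, h2, h3, hQ σ' h4⟩

/-- A specification holds for every initial bound, so the second statement can start from the bound
left by the first; hence exponents multiply. -/
theorem seq {S S' : Stmt} (h : Spec L S σ fun σ' => Spec L S' σ' Q) : Spec L (S ;; S') σ Q := by
  intro b hb hσ
  obtain ⟨σ', t, h1, h2, h3, h4⟩ := h b hb hσ
  obtain ⟨σ'', t', h1', h2', h3', h4'⟩ :=
    h4 _ (hb.trans (Nat.le_self_pow S.deg_pos.ne' b)) h3
  rw [← pow_mul] at h2' h3'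
  refine ⟨σ'', t + t', Nat.add_le_add h1 h1', .seq (h2.mono ?_) h2', h3', h4'⟩
  exact Nat.pow_le_pow_right (by omega) (Nat.le_mul_of_pos_right _ S'.deg_pos)

theorem assign {r : Fin 16} {e : Exp} (he : e.Small)
    (hQ : Q (σ.set r fun p => e.eval σ.mem (σ.V p))) : Spec L (.assign r e) σ Q := by
  intro b hb hσ
  have h := fun p => Exp.bdd_of_below (by omega) hσ.1 (hσ.2 p) e (he.constsBelow hb)
  have hle : b ≤ b ^ e.deg := Nat.le_self_pow e.deg_pos.ne' b
  refine ⟨_, _, le_rfl, .assign r e σ fun p => (h p).1, ⟨fun a => (hσ.1 a).trans_le hle, ?_⟩, hQ⟩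
  intro p r'
  rw [St.set_V]
  split_ifs
  · exact (h p).2
  · exact (hσ.2 p r').trans_le hle

theorem store {x y : Exp} (hx : x.Small) (hy : y.Small)
    (hinj : Function.Injective fun p => x.eval σ.mem (σ.V p))
    (hQ : ∀ mem', Writes σ.mem (fun p => x.eval σ.mem (σ.V p)) (fun p => y.eval σ.mem (σ.V p)) mem'
      → Q ⟨σ.V, mem'⟩) : Spec L (.store x y) σ Q := by
  intro b hb hσ
  classical
  have h := fun p => Exp.bdd_of_below (by omega) hσ.1 (hσ.2 p) x (hx.constsBelow hb)
  have h' := fun p => Exp.bdd_of_below (by omega) hσ.1 (hσ.2 p) y (hy.constsBelow hb)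
  have hle : b ^ x.deg ≤ b ^ (x.deg + y.deg) := Nat.pow_le_pow_right (by omega) (by omega)
  have hle' : b ^ y.deg ≤ b ^ (x.deg + y.deg) := Nat.pow_le_pow_right (by omega) (by omega)
  have hle'' : b ≤ b ^ (x.deg + y.deg) := (Nat.le_self_pow x.deg_pos.ne' b).trans hle
  have hw : Writes σ.mem (fun p => x.eval σ.mem (σ.V p)) (fun p => y.eval σ.mem (σ.V p))
      (fun a => if ha : ∃ p, x.eval σ.mem (σ.V p) = a
        then y.eval σ.mem (σ.V ha.choose) else σ.mem a) := by
    refine ⟨fun p => ?_, fun a ha => dif_neg (by push Not; exact ha)⟩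
    have hp : ∃ q, x.eval σ.mem (σ.V q) = x.eval σ.mem (σ.V p) := ⟨p, rfl⟩
    simp only
    rw [dif_pos hp, hinj hp.choose_spec]
  refine ⟨_, _, le_rfl, .store x y σ _ (fun p => (h p).1.mono hle) (fun p => (h' p).1.mono hle')
    hinj hw, ⟨fun a => ?_, fun p r => (hσ.2 p r).trans_le hle''⟩, hQ _ hw⟩
  simp only [Stmt.deg]
  split_ifs with ha
  · exact (h' _).2.trans_le hle'
  · exact (hσ.1 a).trans_le hle''

/-- Composing the growth of the body over all rounds would give an exponent depending on `L`.
Instead the invariant itself bounds the state by `b ^ 3` before each round, so the exponent of the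
body enters only once. The doubling counter limits the number of rounds to `L`; `hS` holds for a
body without loops. -/
theorem loop {r r' : Fin 16} {S : Stmt} {lim : ℕ} (hS : S.time L = S.time 0) (hL : lim ≤ 2 ^ L)
    (Inv : ℕ → St P → Prop) (h0 : Inv 0 σ)
    (hr : ∀ k σ', Inv k σ' → ∀ p, σ'.V p r = 2 ^ k ∧ σ'.V p r' = lim)
    (hbody : ∀ k σ', Inv k σ' → 2 ^ k < lim → Spec L S σ' (Inv (k + 1)))
    (hbelow : ∀ b k σ', 16 ≤ b → σ.Below b → 2 ^ k ≤ 2 * lim + 1 → Inv k σ' → σ'.Below (b ^ 3))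
    (hQ : ∀ k σ', lim ≤ 2 ^ k → Inv k σ' → Q σ') : Spec L (.loop r r' S) σ Q := by
  intro b hb hσ
  have hdeg : b ^ 3 ≤ b ^ (3 * S.deg) :=
    Nat.pow_le_pow_right (by omega) (Nat.le_mul_of_pos_right 3 S.deg_pos)
  have hb3 : 16 ≤ b ^ 3 := hb.trans (Nat.le_self_pow (by omega) b)
  -- Induction on the number `i` of rounds still allowed. The counter was below `lim` before its
  -- last doubling; the `+ 1` covers its initial value 1 when `lim = 0`.
  have main : ∀ i k σ', k + i = L → 2 ^ k ≤ 2 * lim + 1 → Inv k σ' →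
      ∃ (σ'' : St P) (t : ℕ), t ≤ i * (S.time 0 + 2) + 2 ∧
        Run (b ^ (3 * S.deg)) (.loop r r' S) σ' t σ'' ∧ σ''.Below (b ^ (3 * S.deg)) ∧ Q σ'' := by
    have hdone : ∀ k σ', 2 ^ k ≤ 2 * lim + 1 → Inv k σ' → lim ≤ 2 ^ k → ∀ i,
        ∃ (σ'' : St P) (t : ℕ), t ≤ i * (S.time 0 + 2) + 2 ∧
        Run (b ^ (3 * S.deg)) (.loop r r' S) σ' t σ'' ∧
          σ''.Below (b ^ (3 * S.deg)) ∧ Q σ'' := by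
      intro k σ' hk hI hlim i
      refine ⟨σ', 2, by omega, .loop_done r r' S σ' fun p => ?_,
        (hbelow b k σ' hb hσ hk hI).mono hdeg, hQ k σ' hlim hI⟩
      rw [(hr k σ' hI p).1, (hr k σ' hI p).2]
      omega
    intro i
    induction i with
    | zero =>
      intro k σ' hki hk hI
      exact hdone k σ' hk hI (by rw [show k = L by omega]; exact hL) 0
    | succ i ih =>
      intro k σ' hki hk hI
      rcases lt_or_ge (2 ^ k) lim with hlt | hge
      · obtain ⟨σ₁, t₁, ht₁, hrun₁, -, hI₁⟩ :=
          hbody k σ' hI hlt (b ^ 3) hb3 (hbelow b k σ' hb hσ hk hI)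
        obtain ⟨σ₂, t₂, ht₂, hrun₂, hb₂, hQ₂⟩ :=
          ih (k + 1) σ₁ (by omega) (by rw [pow_succ]; omega) hI₁
        rw [← pow_mul] at hrun₁
        refine ⟨σ₂, _, ?_, .loop_step (fun p => ?_) hrun₁ hrun₂, hb₂, hQ₂⟩
        · rw [hS] at ht₁
          rw [add_mul]
          omega
        · rw [(hr k σ' hI p).1, (hr k σ' hI p).2]
          exact hlt
      · exact hdone k σ' hk hI hge (i + 1)
  exact main L 0 σ (by omega) (by rw [pow_zero]; omega) h0

end Spec

/-! ## Memory layout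

Above the input and the output, eight arrays are interleaved. -/

/-- The address of entry `i` of array `k`. -/
def cell (n m k i : ℕ) : ℕ := 2 * n + 2 * m + 4 + 8 * i + k

/-- The address of entry `i` of array `k`, as an expression; the variables `1` and `2` hold the
numbers of vertices and edges. -/
def Exp.cell (k : ℕ) (i : Exp) : Exp := 2 * reg 1 + 2 * reg 2 + 4 + 8 * i + const k

@[simp] theorem Exp.eval_cell (mem : ℕ → ℕ) (V : Fin 16 → ℕ) (k : ℕ) (i : Exp) :
    (Exp.cell k i).eval mem V = PRAM.cell (V 1) (V 2) k (i.eval mem V) := by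
  simp [Exp.cell, PRAM.cell]

@[simp] theorem Exp.small_cell (k : ℕ) (i : Exp) : (Exp.cell k i).Small ↔ i.Small ∧ k < 16 := by
  simp [Exp.cell]

theorem cell_inj {n m k i i' : ℕ} : cell n m k i = cell n m k i' ↔ i = i' := by
  unfold cell; omega

/-! ## Prefix sums -/

/-- Replace the entries `1, …, P` of array `1` by the prefix sums of the variables `7`, by pointer
doubling up to the limit in variable `13`. -/
def scan : Stmt :=
  .assign 6 1 ;; .assign 8 0 ;; .store (.cell 1 (.reg 0 + 1)) (.reg 7) ;;
  .loop 6 13 (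
    .assign 8 (.load (.cell 1 (.reg 0 + 1 - .reg 6))) ;;
    .assign 7 (.reg 7 + .reg 8) ;;
    .store (.cell 1 (.reg 0 + 1)) (.reg 7) ;;
    .assign 6 (.reg 6 + .reg 6))

/-- The sum of the last `d` of the values `x 0, …, x (i - 1)`. -/
def windowSum (x : ℕ → ℕ) (d i : ℕ) : ℕ := ∑ l ∈ Finset.Ico (i - d) i, x l

/-- Two adjacent windows of length `d` form one of length `2d`. If `i < d`, truncated subtraction
makes the second window empty, so the start of the array needs no special case. -/
theorem windowSum_double (x : ℕ → ℕ) (d i : ℕ) :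
    windowSum x d i + windowSum x d (i - d) = windowSum x (d + d) i := by
  unfold windowSum
  rw [add_comm, Nat.sub_sub, Finset.sum_Ico_consecutive _ (by omega) (by omega)]

theorem windowSum_le {x : ℕ → ℕ} {P b : ℕ} (hx : ∀ l < P, x l ≤ b) (d : ℕ) {i : ℕ} (hi : i ≤ P) :
    windowSum x d i ≤ d * b := by
  refine (Finset.sum_le_card_nsmul _ _ b fun l hl => hx l ?_).trans ?_
  · rw [Finset.mem_Ico] at hl
    omega
  · rw [Nat.card_Ico, smul_eq_mul]
    exact Nat.mul_le_mul_right b (by omega)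

theorem windowSum_of_le (x : ℕ → ℕ) {d i : ℕ} (h : i ≤ d) :
    windowSum x d i = ∑ l ∈ Finset.range i, x l := by
  rw [windowSum, Nat.sub_eq_zero_of_le h, Finset.range_eq_Ico]

/-- What `scan` does: the entry `i` of array `1` becomes the sum of the first `i` values. -/
structure Scanned {P : ℕ} (n m lim : ℕ) (x : ℕ → ℕ) (σ σ' : St P) : Prop where
  reg : ∀ p r, r ≠ 6 → r ≠ 7 → r ≠ 8 → σ'.V p r = σ.V p r
  mem : ∀ a, (∀ i, a ≠ cell n m 1 i) → σ'.mem a = σ.mem a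
  sum : ∀ i, i ≤ P → i ≤ lim → σ'.mem (cell n m 1 i) = ∑ l ∈ Finset.range i, x l

/-- The invariant of the loop of `scan`. -/
structure ScanInv {P : ℕ} (n m : ℕ) (x : ℕ → ℕ) (σ : St P) (d : ℕ) (σ' : St P) : Prop where
  reg : ∀ p r, r ≠ 6 → r ≠ 7 → r ≠ 8 → σ'.V p r = σ.V p r
  mem : ∀ a, (∀ i, i ≤ P → a ≠ cell n m 1 i) → σ'.mem a = σ.mem a
  step : ∀ p, σ'.V p 6 = d
  val : ∀ p : Fin P, σ'.V p 7 = windowSum x d (p + 1)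
  aux : ∀ p, σ'.V p 8 ≤ σ'.V p 7
  sum : ∀ i, i ≤ P → σ'.mem (cell n m 1 i) = windowSum x d i

/-- After `k` rounds entry `i` holds the sum of the last `2 ^ k` values before `i`, a full prefix
sum once `i ≤ 2 ^ k`. Only entries up to `lim` are claimed, since `P` may be larger. In each round
every processor finishes its load before any processor stores. -/
theorem scan_spec {L n m lim : ℕ} {σ : St P} (x : ℕ → ℕ) (hL : lim ≤ 2 ^ L)
    (h0 : ∀ p, σ.V p 0 = p) (h1 : ∀ p, σ.V p 1 = n) (h2 : ∀ p, σ.V p 2 = m)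
    (hlim : ∀ p, σ.V p 13 = lim) (hx : ∀ p, σ.V p 7 = x p)
    (hX : σ.mem (cell n m 1 0) = 0) : Spec L scan σ (Scanned n m lim x σ) := by
  refine .seq (.assign (by simp) (.seq (.assign (by simp) (.seq (.store (by simp) (by simp) ?_ ?_)))))
  · intro p q hpq
    simpa [h0, h1, h2, cell_inj, Fin.ext_iff] using hpq
  intro mem' hw
  simp only [Exp.eval_cell, Exp.eval_add, Exp.eval_reg, Exp.eval_ofNat, St.set_V, St.set_mem,
    Fin.reduceEq, if_false, h0, h1, h2, hx] at hw
  have init : ScanInv n m x σ (2 ^ 0)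
      ⟨((σ.set 6 fun _ => 1).set 8 fun _ => 0).V, mem'⟩ := by
    refine ⟨fun p r h6 h7 h8 => by simp [h6, h8], fun a ha => hw.2 a fun p => (ha _ p.2).symm,
      fun p => by simp, fun p => by simp [hx, windowSum], fun p => by simp, fun i hi => ?_⟩
    change mem' _ = _
    -- Processor `p` owns entry `p + 1`; entry 0 is written by nobody and stays 0, the empty sum.
    rcases i with - | i
    · rw [windowSum_of_le x (Nat.zero_le _), hw.2, hX, Finset.sum_range_zero]
      intro p
      rw [Ne, cell_inj]
      omega
    · rw [hw.1 ⟨i, hi⟩]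
      simp [windowSum]
  refine .loop rfl hL (fun k => ScanInv n m x σ (2 ^ k)) init ?_ ?_ ?_ ?_
  · intro k σ' h p
    exact ⟨h.step p, by rw [h.reg p 13 (by decide) (by decide) (by decide), hlim]⟩
  · intro k σ' h _
    have g0 : ∀ p, σ'.V p 0 = p := fun p => by
      rw [h.reg p 0 (by decide) (by decide) (by decide), h0]
    have g1 : ∀ p, σ'.V p 1 = n := fun p => by
      rw [h.reg p 1 (by decide) (by decide) (by decide), h1]
    have g2 : ∀ p, σ'.V p 2 = m := fun p => by
      rw [h.reg p 2 (by decide) (by decide) (by decide), h2]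
    refine .seq (.assign (by simp) (.seq (.assign (by simp)
      (.seq (.store (by simp) (by simp) ?_ ?_)))))
    · intro p q hpq
      simpa [g0, g1, g2, cell_inj, Fin.ext_iff] using hpq
    intro mem'' hw
    refine .assign (by simp) ?_
    have hnew : ∀ p : Fin P, windowSum x (2 ^ k) (p + 1) + windowSum x (2 ^ k) (p + 1 - 2 ^ k) =
        windowSum x (2 ^ (k + 1)) (p + 1) := fun p => by
      rw [windowSum_double, pow_succ, mul_two]
    have hread : ∀ p : Fin P, σ'.mem (cell n m 1 (p + 1 - 2 ^ k)) =
        windowSum x (2 ^ k) (p + 1 - 2 ^ k) := fun p => h.sum _ ((Nat.sub_le _ _).trans p.2)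
    simp only [Exp.eval_cell, Exp.eval_add, Exp.eval_sub, Exp.eval_load, Exp.eval_reg,
      Exp.eval_ofNat, St.set_V, St.set_mem, Fin.reduceEq, if_false, if_true, g0, g1, g2,
      h.step, h.val, hread, hnew] at hw
    refine ⟨fun p r h6 h7 h8 => by simp [h6, h7, h8, h.reg],
      fun a ha => ?_, fun p => ?_, fun p => ?_, fun p => ?_, fun i hi => ?_⟩
    · rw [← h.mem a ha]
      exact hw.2 a fun p => (ha _ p.2).symm
    · simp [h.step, pow_succ, mul_two]
    · simp [h.step, h.val, g0, g1, g2, hread, hnew]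
    · simp
    · change mem'' _ = _
      rcases i with - | i
      · rw [hw.2]
        · rw [h.sum 0 (by omega), windowSum_of_le x (Nat.zero_le _), windowSum_of_le x (Nat.zero_le _)]
        intro p
        rw [Ne, cell_inj]
        omega
      · exact hw.1 ⟨i, hi⟩
  · intro b k σ' hb hσ hk h
    have hxb : ∀ l < P, x l ≤ b := fun l hl => by
      have := hσ.2 ⟨l, hl⟩ 7
      simp only [St.set_V, Fin.reduceEq, if_false, hx] at this
      exact this.le
    have hbb : b ≤ b ^ 3 := Nat.le_self_pow (by omega) b
    have hlimb : ∀ p : Fin P, lim < b := fun p => by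
      have := hσ.2 p 13
      simpa only [St.set_V, Fin.reduceEq, if_false, hlim] using this
    -- For `i = 0` there may be no processor whose variable 13 shows `lim < b`, but the sum is
    -- empty. Otherwise at most `2 * b` values of size at most `b` are added.
    have hwin : ∀ i, i ≤ P → windowSum x (2 ^ k) i < b ^ 3 := fun i hi => by
      rcases Nat.eq_zero_or_pos i with rfl | hi'
      · rw [windowSum_of_le x (Nat.zero_le _), Finset.sum_range_zero]
        positivity
      · have hl := hlimb ⟨0, by omega⟩
        calc _ ≤ 2 ^ k * b := windowSum_le hxb _ hi
          _ ≤ (2 * b) * b := Nat.mul_le_mul_right b (by omega)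
          _ < b ^ 3 := by nlinarith [Nat.mul_pos (show 0 < b by omega) (show 0 < b by omega)]
    refine ⟨fun a => ?_, fun p r => ?_⟩
    · by_cases ha : ∃ i, i ≤ P ∧ a = cell n m 1 i
      · obtain ⟨i, hi, rfl⟩ := ha
        rw [h.sum i hi]
        exact hwin i hi
      · push Not at ha
        rw [h.mem a ha, ← hw.2 a fun p => (ha _ p.2).symm]
        exact (hσ.1 a).trans_le hbb
    · by_cases h6 : r = 6
      · rw [h6, h.step]
        have hl := hlimb p
        calc 2 ^ k ≤ 2 * b := by omega
          _ < b ^ 3 := by nlinarith [Nat.mul_pos (show 0 < b by omega) (show 0 < b by omega)]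
      by_cases h7 : r = 7
      · rw [h7, h.val]
        exact hwin _ p.2
      by_cases h8 : r = 8
      · rw [h8]
        refine (h.aux p).trans_lt ?_
        rw [h.val]
        exact hwin _ p.2
      · have := hσ.2 p r
        simp only [St.set_V, h6, h8, if_false] at this
        rw [h.reg p r h6 h7 h8]
        exact this.trans_le hbb
  · intro k σ' hk h
    exact ⟨h.reg, fun a ha => h.mem a fun i _ => ha i,
      fun i hi hi' => by rw [h.sum i hi, windowSum_of_le x (by omega)]⟩

end PRAM

namespace PRAM

variable {P : ℕ}

/-! ## The number of vertices, the number of edges, and its approximate square root -/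

/-- Put the numbers of vertices and edges into the variables `1` and `2`, and a number `s` near the
square root of the number of edges into variable `3`. -/
def sizes : Stmt :=
  .assign 1 (.load 0) ;; .assign 2 (.load 1) ;; .assign 3 1 ;; .assign 6 1 ;;
  .assign 13 (.reg 2) ;;
  .loop 6 13 (
    .assign 3 (.cond (.lt (.reg 3 * .reg 3) (.reg 2)) (.reg 3 + .reg 3) (.reg 3)) ;;
    .assign 6 (.reg 6 + .reg 6))

/-- What `sizes` does. -/
structure Sized (n m s : ℕ) (σ σ' : St P) : Prop where
  mem : σ'.mem = σ.mem
  idx : ∀ p, σ'.V p 0 = σ.V p 0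
  vertices : ∀ p, σ'.V p 1 = n
  edges : ∀ p, σ'.V p 2 = m
  block : ∀ p, σ'.V p 3 = s

/-- `s` doubles while `s * s < m`, that is, only when `s ≤ Nat.sqrt m`, whence the upper bound.
Either `s` has doubled in every round, so `s = 2 ^ k`, or `m ≤ s * s` is already reached; since the
loop ends with `m ≤ 2 ^ k`, both cases give `m ≤ s * s`. -/
theorem sizes_spec {L n m : ℕ} {σ : St P} (hL : m ≤ 2 ^ L) (hm : 0 < m)
    (hn : σ.mem 0 = n) (hm' : σ.mem 1 = m) :
    Spec L sizes σ fun σ' =>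
      ∃ s, 0 < s ∧ m ≤ s * s ∧ s ≤ 2 * Nat.sqrt m ∧ Sized n m s σ σ' := by
  refine .seq (.assign (by simp) (.seq (.assign (by simp) (.seq (.assign (by simp)
    (.seq (.assign (by simp) (.seq (.assign (by simp) ?_)))))))))
  refine .loop rfl hL (fun k σ' => ∃ s, 0 < s ∧ (s = 2 ^ k ∨ m ≤ s * s) ∧ s ≤ 2 ^ k ∧
    s ≤ 2 * Nat.sqrt m ∧ Sized n m s σ σ' ∧ (∀ p, σ'.V p 6 = 2 ^ k) ∧ (∀ p, σ'.V p 13 = m) ∧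
    ∀ p (r : Fin 16), r ≠ 1 → r ≠ 2 → r ≠ 3 → r ≠ 6 → r ≠ 13 → σ'.V p r = σ.V p r) ?_ ?_ ?_ ?_ ?_
  · refine ⟨1, one_pos, .inl (pow_zero 2).symm, (pow_zero 2).ge, ?_, ⟨rfl, fun p => by simp,
      fun p => by simp [hn], fun p => by simp [hm'], fun p => by simp⟩, fun p => by simp,
      fun p => by simp [hm'], fun p r h1 h2 h3 h6 h13 => by simp [h1, h2, h3, h6, h13]⟩
    have := Nat.sqrt_pos.2 hm
    omega
  · rintro k σ' ⟨s, -, -, -, -, -, h6, h13, -⟩ p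
    exact ⟨h6 p, h13 p⟩
  · rintro k σ' ⟨s, h0, hs, hsk, hsq, hS, h6, h13, hreg⟩ hk
    refine .seq (.assign (by simp) (.assign (by simp) ?_))
    refine ⟨if s * s < m then s + s else s, ?_, ?_, ?_, ?_, ⟨hS.mem, fun p => by simp [hS.idx],
      fun p => by simp [hS.vertices], fun p => by simp [hS.edges],
      fun p => by simp [hS.edges, hS.block]⟩, fun p => by simp [h6, pow_succ, mul_two],
      fun p => by simp [h13],
      fun p r g1 g2 g3 g6 g13 => by simp [g3, g6, hreg p r g1 g2 g3 g6 g13]⟩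
    · split_ifs <;> omega
    · split_ifs with h
      · rcases hs with hs | hs
        · left; rw [pow_succ]; omega
        · omega
      · right; omega
    · rw [pow_succ]; split_ifs <;> omega
    · split_ifs with h
      · have : s ≤ Nat.sqrt m := Nat.le_sqrt.2 h.le
        omega
      · exact hsq
  · rintro b k σ' hb hσ hk ⟨s, -, -, hsk, -, hS, h6, h13, hreg⟩
    have hbb : b ≤ b ^ 3 := Nat.le_self_pow (by omega) b
    refine ⟨fun a => by rw [hS.mem]; exact (hσ.1 a).trans_le hbb, fun p r => ?_⟩
    have hmb : m < b := by simpa [hm'] using hσ.2 p 2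
    have hd : 2 ^ k < b ^ 3 := calc
      2 ^ k ≤ 2 * b := by omega
      _ < b ^ 3 := by nlinarith [Nat.mul_pos (show 0 < b by omega) (show 0 < b by omega)]
    by_cases g1 : r = 1
    · rw [g1, hS.vertices]
      refine lt_of_lt_of_le ?_ hbb
      simpa [hn] using hσ.2 p 1
    by_cases g2 : r = 2
    · rw [g2, hS.edges]; exact hmb.trans_le hbb
    by_cases g3 : r = 3
    · rw [g3, hS.block]; exact hsk.trans_lt hd
    by_cases g6 : r = 6
    · rw [g6, h6]; exact hd
    by_cases g13 : r = 13
    · rw [g13, h13]; exact hmb.trans_le hbb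
    · rw [hreg p r g1 g2 g3 g6 g13]
      have := hσ.2 p r
      simp only [St.set_V, g1, g2, g3, g6, g13, if_false] at this
      exact this.trans_le hbb
  · rintro k σ' hk ⟨s, h0, hs, -, hsq, hS, -⟩
    refine ⟨s, h0, ?_, hsq, hS⟩
    rcases hs with rfl | hs
    · nlinarith
    · exact hs

/-! ## Binary search -/

/-- Find, in variable `4`, the vertex with the adjacency array of which the arc of the processor
begins. -/
def search : Stmt :=
  .assign 4 0 ;; .assign 5 (.reg 1) ;; .assign 8 0 ;; .assign 6 1 ;; .assign 13 (.reg 1 + 1) ;;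
  .loop 6 13 (
    .assign 8 ((.reg 4 + .reg 5) / 2) ;;
    .assign 4 (.cond (.lt (.reg 0) (.load (2 + .reg 8))) (.reg 4) (.reg 8)) ;;
    .assign 5 (.cond (.lt (.reg 0) (.load (2 + .reg 8))) (.reg 8) (.reg 5)) ;;
    .assign 6 (.reg 6 + .reg 6))

/-- What `search` does. -/
structure Searched (n : ℕ) (σ σ' : St P) : Prop where
  mem : σ'.mem = σ.mem
  reg : ∀ p r, r ≠ 4 → r ≠ 5 → r ≠ 6 → r ≠ 8 → r ≠ 13 → σ'.V p r = σ.V p r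
  found : ∀ p : Fin P, σ.mem 2 ≤ p → p < σ.mem (2 + n) → σ'.V p 4 < n ∧
    σ.mem (2 + σ'.V p 4) ≤ p ∧ p < σ.mem (2 + (σ'.V p 4 + 1))

/-- The invariant of the loop of `search`. -/
structure SearchInv (n : ℕ) (σ : St P) (d : ℕ) (σ' : St P) : Prop where
  mem : σ'.mem = σ.mem
  reg : ∀ p r, r ≠ 4 → r ≠ 5 → r ≠ 6 → r ≠ 8 → r ≠ 13 → σ'.V p r = σ.V p r
  step : ∀ p, σ'.V p 6 = d
  lim : ∀ p, σ'.V p 13 = n + 1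
  lo_le : ∀ p, σ'.V p 4 ≤ σ'.V p 5
  hi_le : ∀ p, σ'.V p 5 ≤ n
  mid_le : ∀ p, σ'.V p 8 ≤ n
  width : ∀ p, (σ'.V p 5 - σ'.V p 4 - 1) * d ≤ n
  found : ∀ p : Fin P, σ.mem 2 ≤ p → p < σ.mem (2 + n) →
    σ.mem (2 + σ'.V p 4) ≤ p ∧ p < σ.mem (2 + σ'.V p 5)

/-- The search keeps `off lo ≤ p < off hi`, so `lo` and `hi` never meet, while `hi - lo - 1` is
halved in each round. It starts below `n`, so the limit `n + 1` forces it to 0. Processors that hold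
no arc search too, with a meaningless result. -/
theorem search_spec {L n : ℕ} {σ : St P} (hL : n + 1 ≤ 2 ^ L)
    (h0 : ∀ p, σ.V p 0 = p) (h1 : ∀ p, σ.V p 1 = n) : Spec L search σ (Searched n σ) := by
  refine .seq (.assign (by simp) (.seq (.assign (by simp) (.seq (.assign (by simp)
    (.seq (.assign (by simp) (.seq (.assign (by simp) ?_)))))))))
  refine .loop rfl hL (fun k => SearchInv n σ (2 ^ k)) ?_ ?_ ?_ ?_ ?_
  · exact ⟨rfl, fun p r g4 g5 g6 g8 g13 => by simp [g4, g5, g6, g8, g13], fun p => by simp,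
      fun p => by simp [h1], fun p => by simp, fun p => by simp [h1], fun p => by simp,
      fun p => by simp [h1], fun p hp hp' => by simpa [h1] using ⟨hp, hp'⟩⟩
  · exact fun k σ' h p => ⟨h.step p, h.lim p⟩
  · intro k σ' h hk
    refine .seq (.assign (by simp) (.seq (.assign (by simp) (.seq (.assign (by simp)
      (.assign (by simp) ?_))))))
    have g0 : ∀ p, σ'.V p 0 = p := fun p => by
      rw [h.reg p 0 (by decide) (by decide) (by decide) (by decide) (by decide), h0]
    refine ⟨h.mem, fun p r g4 g5 g6 g8 g13 => by simp [g4, g5, g6, g8, h.reg p r g4 g5 g6 g8 g13],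
      fun p => by simp [h.step, pow_succ, mul_two], fun p => by simp [h.lim],
      fun p => ?_, fun p => ?_, fun p => ?_, fun p => ?_, fun p hp hp' => ?_⟩
    all_goals
      have hlo := h.lo_le p
      have hhi := h.hi_le p
      simp only [Exp.eval_cond_lt, Exp.eval_add, Exp.eval_div, Exp.eval_load, Exp.eval_reg,
        Exp.eval_ofNat, St.set_V, St.set_mem, Fin.reduceEq, if_false, if_true, g0, h.mem]
    · split_ifs <;> omega
    · split_ifs <;> omega
    · omega
    · refine le_trans ?_ (h.width p)
      rw [pow_succ, mul_comm (2 ^ k) 2, ← mul_assoc]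
      refine Nat.mul_le_mul_right _ ?_
      split_ifs <;> omega
    · obtain ⟨f1, f2⟩ := h.found p hp hp'
      split_ifs with hlt
      · exact ⟨f1, hlt⟩
      · exact ⟨not_lt.1 hlt, f2⟩
  · intro b k σ' hb hσ hk h
    have hbb : b ≤ b ^ 3 := Nat.le_self_pow (by omega) b
    refine ⟨fun a => by rw [h.mem]; exact (hσ.1 a).trans_le hbb, fun p r => ?_⟩
    have hnb : n + 1 < b := by simpa [h1] using hσ.2 p 13
    have hd : 2 ^ k < b ^ 3 := calc
      2 ^ k ≤ 2 * b := by omega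
      _ < b ^ 3 := by nlinarith [Nat.mul_pos (show 0 < b by omega) (show 0 < b by omega)]
    have hlo := h.lo_le p
    have hhi := h.hi_le p
    by_cases g4 : r = 4
    · subst g4; omega
    by_cases g5 : r = 5
    · subst g5; omega
    by_cases g6 : r = 6
    · rw [g6, h.step]; exact hd
    by_cases g8 : r = 8
    · have := h.mid_le p
      subst g8; omega
    by_cases g13 : r = 13
    · rw [g13, h.lim]; omega
    · rw [h.reg p r g4 g5 g6 g8 g13]
      have := hσ.2 p r
      simp only [St.set_V, g4, g5, g6, g8, g13, if_false] at this
      exact this.trans_le hbb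
  · intro k σ' hk h
    refine ⟨h.mem, h.reg, fun p hp hp' => ?_⟩
    obtain ⟨f1, f2⟩ := h.found p hp hp'
    have hlo := h.lo_le p
    have hhi := h.hi_le p
    have hw : σ'.V p 5 - σ'.V p 4 - 1 = 0 := by
      have := h.width p
      by_contra hne
      have : 2 ^ k ≤ (σ'.V p 5 - σ'.V p 4 - 1) * 2 ^ k :=
        Nat.le_mul_of_pos_left _ (Nat.pos_of_ne_zero hne)
      omega
    have hne : σ'.V p 4 ≠ σ'.V p 5 := fun he => by rw [he] at f1; omega
    have he : σ'.V p 5 = σ'.V p 4 + 1 := by omega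
    rw [he] at f2
    exact ⟨by omega, f1, f2⟩

end PRAM

namespace TriangleCentrality

/-! ## Counting triangles -/

variable {V : Type*} [Fintype V] [DecidableEq V] (G : SimpleGraph V) [DecidableRel G.Adj]

/-- A common neighbour `w` corresponds to the triangle `{u, v, w}`; conversely `w` is what remains
of a triangle after erasing `u` and `v`. -/
theorem card_common_neighbors {u v : V} (h : G.Adj u v) :
    (G.neighborFinset u ∩ G.neighborFinset v).card =
      ((G.cliqueFinset 3).filter fun s => u ∈ s ∧ v ∈ s).card := by
  refine Finset.card_bij (fun w _ => {u, v, w}) (fun w hw => ?_) (fun w hw w' hw' he => ?_)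
    fun s hs => ?_
  · simp only [Finset.mem_inter, SimpleGraph.mem_neighborFinset] at hw
    simp [SimpleGraph.mem_cliqueFinset_iff, SimpleGraph.is3Clique_triple_iff, h, hw.1, hw.2]
  · simp only [Finset.mem_inter, SimpleGraph.mem_neighborFinset] at hw
    have : w ∈ ({u, v, w'} : Finset V) := by rw [← he]; simp
    simpa [hw.1.ne', hw.2.ne'] using this
  · simp only [Finset.mem_filter, SimpleGraph.mem_cliqueFinset_iff] at hs
    obtain ⟨hs, hu, hv⟩ := hs
    have hvu : v ∈ s.erase u := Finset.mem_erase.2 ⟨h.ne', hv⟩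
    have hcard : ((s.erase u).erase v).card = 1 := by
      rw [Finset.card_erase_of_mem hvu, Finset.card_erase_of_mem hu, hs.card_eq]
    obtain ⟨w, hw⟩ := Finset.card_eq_one.1 hcard
    have hs' : {u, v, w} = s := by rw [← hw, Finset.insert_erase hvu, Finset.insert_erase hu]
    rw [← hs', SimpleGraph.is3Clique_triple_iff] at hs
    exact ⟨w, by simpa using hs.2, hs'⟩

/-- Double counting of pairs of a triangle at `u` and a neighbour of `u` in it: each triangle has
exactly two vertices besides `u`. -/
theorem sum_common_neighbors (u : V) :
    ∑ v ∈ G.neighborFinset u, (G.neighborFinset u ∩ G.neighborFinset v).card =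
      2 * trianglesAt G u := by
  have h1 : ∀ v ∈ G.neighborFinset u, (G.neighborFinset u ∩ G.neighborFinset v).card =
      (((G.cliqueFinset 3).filter fun s => u ∈ s).filter fun s => v ∈ s).card := fun v hv => by
    rw [card_common_neighbors G ((G.mem_neighborFinset u v).1 hv), Finset.filter_filter]
  have h2 := Finset.sum_card_bipartiteAbove_eq_sum_card_bipartiteBelow (s := G.neighborFinset u)
    (t := (G.cliqueFinset 3).filter fun s => u ∈ s) (fun v s => v ∈ s)
  unfold Finset.bipartiteAbove at h2
  rw [Finset.sum_congr rfl h1, h2, trianglesAt, mul_comm, ← smul_eq_mul, ← Finset.sum_const]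
  refine Finset.sum_congr rfl fun s hs => ?_
  simp only [Finset.mem_filter, SimpleGraph.mem_cliqueFinset_iff] at hs
  have : (G.neighborFinset u).filter (fun v => v ∈ s) = s.erase u := by
    ext v
    simp only [Finset.mem_filter, SimpleGraph.mem_neighborFinset, Finset.mem_erase]
    exact ⟨fun h => ⟨h.1.ne', h.2⟩, fun h => ⟨hs.1.isClique hs.2 h.2 h.1.symm, h.2⟩⟩
  rw [Finset.bipartiteBelow, this, Finset.card_erase_of_mem hs.2, hs.1.card_eq]

theorem sum_trianglesAt : ∑ u, trianglesAt G u = 3 * triangles G := by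
  unfold trianglesAt triangles
  have := Finset.sum_card_bipartiteAbove_eq_sum_card_bipartiteBelow
    (s := (Finset.univ : Finset V)) (t := G.cliqueFinset 3) (fun u s => u ∈ s)
  unfold Finset.bipartiteAbove at this
  rw [this, mul_comm, ← smul_eq_mul, ← Finset.sum_const]
  refine Finset.sum_congr rfl fun s hs => ?_
  rw [SimpleGraph.mem_cliqueFinset_iff] at hs
  rw [Finset.bipartiteBelow, Finset.filter_univ_mem, hs.card_eq]

/-- Clearing the factor 1/3 and working with the doubled counts `2 * trianglesAt` that row sums
deliver explains the scaling by 6. Neighbours outside `triangleNeighbors` are those without a common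
neighbour with `v`; they get weight 3. -/
theorem TC_eq (v : V) : TC G v =
    ((2 * trianglesAt G v + ∑ w ∈ G.neighborFinset v,
      (if (G.neighborFinset v ∩ G.neighborFinset w).card = 0 then 3 else 1) *
        (2 * trianglesAt G w) : ℕ) : ℚ) / ((6 * triangles G : ℕ) : ℚ) := by
  have hv : v ∉ triangleNeighbors G v := fun h => by
    simp [triangleNeighbors] at h
  have hsplit : ∑ w ∈ G.neighborFinset v,
      (if (G.neighborFinset v ∩ G.neighborFinset w).card = 0 then 3 else 1) *
        (2 * trianglesAt G w) =
      ∑ w ∈ G.neighborFinset v \ triangleNeighbors G v, 3 * (2 * trianglesAt G w) +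
        ∑ w ∈ triangleNeighbors G v, 2 * trianglesAt G w := by
    rw [← Finset.sum_sdiff (Finset.filter_subset _ _ :
      triangleNeighbors G v ⊆ G.neighborFinset v)]
    congr 1
    · refine Finset.sum_congr rfl fun w hw => ?_
      rw [if_pos]
      rw [Finset.mem_sdiff] at hw
      rw [Finset.card_eq_zero, Finset.inter_comm, ← Finset.not_nonempty_iff_eq_empty]
      exact fun h => hw.2 (Finset.mem_filter.2 ⟨hw.1, h⟩)
    · refine Finset.sum_congr rfl fun w hw => ?_
      rw [if_neg, one_mul]
      rw [Finset.card_eq_zero, Finset.inter_comm, ← Ne, ← Finset.nonempty_iff_ne_empty]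
      exact (Finset.mem_filter.1 hw).2
  rw [hsplit, TC, Finset.sum_insert hv, ← Finset.mul_sum, ← Finset.mul_sum, ← Finset.mul_sum]
  push_cast
  rw [show (6 * (triangles G : ℚ)) = triangles G * 6 by ring, ← div_div, eq_div_iff (by norm_num),
    div_mul_eq_mul_div]
  congr 1
  ring

end TriangleCentrality

namespace PRAM

/-! ## Graphs in memory -/

section

variable {n : ℕ} (G : SimpleGraph (Fin n)) [DecidableRel G.Adj]

/-- Adjacency as a number, for vertices given by numbers. -/
def adjNat (a b : ℕ) : ℕ := if h : a < n ∧ b < n then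
  (if G.Adj ⟨a, h.1⟩ ⟨b, h.2⟩ then 1 else 0) else 0

theorem adjNat_fin (u v : Fin n) : adjNat G u v = if G.Adj u v then 1 else 0 := by
  simp [adjNat]

theorem sum_adjNat (u v : Fin n) : ∑ w ∈ G.neighborFinset u, adjNat G w v =
    (G.neighborFinset u ∩ G.neighborFinset v).card := by
  simp only [adjNat_fin]
  rw [← Finset.card_filter]
  congr 1
  ext w
  simp [G.adj_comm w v]

variable {G} {M : ℕ → ℕ} (hM : HoldsGraph G M)

/-- The adjacency array of `u` contains position `e`. -/
def IsTail (n : ℕ) (M : ℕ → ℕ) (e u : ℕ) : Prop := u < n ∧ M (2 + u) ≤ e ∧ e < M (2 + (u + 1))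

include hM

theorem HoldsGraph.offset_mono {a b : ℕ} (hab : a ≤ b) (hb : b ≤ n) : M (2 + a) ≤ M (2 + b) := by
  induction b, hab using Nat.le_induction with
  | base => exact le_rfl
  | succ b hab ih => exact (ih (by omega)).trans (by
      rw [hM.offset_succ ⟨b, hb⟩]; exact Nat.le_add_right _ _)

theorem HoldsGraph.offset_last : M (2 + n) = 2 * G.edgeFinset.card := by
  have h : ∀ k, k ≤ n → M (2 + k) =
      ∑ i ∈ Finset.range k, if h : i < n then G.degree ⟨i, h⟩ else 0 := by
    intro k hk
    induction k with
    | zero => exact hM.offset_zero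
    | succ k ih =>
      rw [hM.offset_succ ⟨k, hk⟩, ih (by omega), Finset.sum_range_succ, dif_pos (by omega)]
  rw [h n le_rfl, ← G.sum_degrees_eq_twice_card_edges, Finset.sum_range]
  simp

/-- As many positions as values: the image has `G.degree v` elements. -/
theorem HoldsGraph.injOn (v : Fin n) :
    Set.InjOn (fun i => M (n + 3 + M (2 + (v : ℕ)) + i)) (Finset.range (G.degree v)) := by
  rw [← Finset.card_image_iff, hM.neighbors v, Finset.card_image_of_injective _ Fin.val_injective,
    G.card_neighborFinset_eq_degree, Finset.card_range]

/-- A sum over the adjacency array of a vertex is a sum over its neighbours. -/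
theorem HoldsGraph.sum_arcs (v : Fin n) (f : ℕ → ℕ) :
    ∑ i ∈ Finset.range (G.degree v), f (M (n + 3 + M (2 + (v : ℕ)) + i)) =
      ∑ w ∈ G.neighborFinset v, f w := by
  rw [← Finset.sum_image (f := f) (hM.injOn v), hM.neighbors v,
    Finset.sum_image fun a _ b _ h => Fin.val_injective h]

theorem IsTail.exists_index {e u : ℕ} (h : IsTail n M e u) :
    ∃ i, i < G.degree ⟨u, h.1⟩ ∧ e = M (2 + u) + i := by
  have := hM.offset_succ ⟨u, h.1⟩
  have h1 := h.2.1
  have h2 := h.2.2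
  simp only at this
  exact ⟨e - M (2 + u), by omega, by omega⟩

theorem HoldsGraph.isTail (v : Fin n) {i : ℕ} (hi : i < G.degree v) :
    IsTail n M (M (2 + (v : ℕ)) + i) v := by
  refine ⟨v.2, Nat.le_add_right _ _, ?_⟩
  rw [hM.offset_succ]
  omega

theorem IsTail.unique {e u u' : ℕ} (h : IsTail n M e u) (h' : IsTail n M e u') : u = u' := by
  obtain ⟨a1, a2, a3⟩ := h
  obtain ⟨b1, b2, b3⟩ := h'
  rcases lt_trichotomy u u' with hlt | heq | hgt
  · have := hM.offset_mono (a := u + 1) (b := u') hlt b1.le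
    omega
  · exact heq
  · have := hM.offset_mono (a := u' + 1) (b := u) hgt a1.le
    omega

theorem IsTail.lt {e u : ℕ} (h : IsTail n M e u) : e < 2 * G.edgeFinset.card := by
  have := hM.offset_mono (a := u + 1) (b := n) h.1 le_rfl
  rw [hM.offset_last] at this
  exact h.2.2.trans_le this

theorem IsTail.exists_head {e u : ℕ} (h : IsTail n M e u) :
    ∃ w : Fin n, M (n + 3 + e) = w ∧ G.Adj ⟨u, h.1⟩ w := by
  obtain ⟨i, hi, rfl⟩ := h.exists_index hM
  have : M (n + 3 + M (2 + u) + i) ∈ (G.neighborFinset ⟨u, h.1⟩).image fun w : Fin n => (w : ℕ) := by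
    rw [← hM.neighbors]
    exact Finset.mem_image_of_mem (fun i => M (n + 3 + M (2 + u) + i)) (Finset.mem_range.2 hi)
  obtain ⟨w, hw, hw'⟩ := Finset.mem_image.1 this
  exact ⟨w, by rw [← add_assoc, hw'], (G.mem_neighborFinset _ _).1 hw⟩

theorem HoldsGraph.exists_arc {u v : Fin n} (h : G.Adj u v) :
    ∃ e, IsTail n M e u ∧ M (n + 3 + e) = v := by
  have : (v : ℕ) ∈ (G.neighborFinset u).image fun w : Fin n => (w : ℕ) :=
    Finset.mem_image_of_mem _ ((G.mem_neighborFinset u v).2 h)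
  rw [← hM.neighbors] at this
  obtain ⟨i, hi, hi'⟩ := Finset.mem_image.1 this
  exact ⟨M (2 + (u : ℕ)) + i, hM.isTail u (Finset.mem_range.1 hi), by rw [← hi']; simp only [add_assoc]⟩

/-- An arc is determined by its tail and head; this is what makes the writes to the adjacency matrix
exclusive. -/
theorem IsTail.head_inj {e e' u : ℕ} (h : IsTail n M e u) (h' : IsTail n M e' u)
    (he : M (n + 3 + e) = M (n + 3 + e')) : e = e' := by
  obtain ⟨i, hi, rfl⟩ := h.exists_index hM
  obtain ⟨j, hj, rfl⟩ := h'.exists_index hM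
  have := hM.injOn ⟨u, h.1⟩ (Finset.mem_coe.2 (Finset.mem_range.2 hi))
    (Finset.mem_coe.2 (Finset.mem_range.2 hj)) (by simpa only [add_assoc] using he)
  rw [this]

/-- Sums over all entries of all adjacency arrays. -/
theorem HoldsGraph.sum_all (f : ℕ → ℕ) : ∑ e ∈ Finset.range (2 * G.edgeFinset.card), f e =
    ∑ v : Fin n, ∑ i ∈ Finset.range (G.degree v), f (M (2 + (v : ℕ)) + i) := by
  have h : ∀ k, k ≤ n → ∑ e ∈ Finset.range (M (2 + k)), f e =
      ∑ j ∈ Finset.range k, if h : j < n then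
        ∑ i ∈ Finset.range (G.degree ⟨j, h⟩), f (M (2 + j) + i) else 0 := by
    intro k hk
    induction k with
    | zero => rw [add_zero, hM.offset_zero, Finset.sum_range_zero, Finset.sum_range_zero]
    | succ k ih =>
      rw [hM.offset_succ ⟨k, hk⟩, Finset.sum_range_add, ih (by omega), Finset.sum_range_succ,
        dif_pos (by omega)]
  rw [← hM.offset_last, h n le_rfl, Finset.sum_range]
  simp

end

end PRAM

namespace PRAM

/-! ## Preparation: tails, heads, and the adjacency matrix -/

/-- Compute the sizes, the tail (variable `4`) and the head (variable `9`) of each arc, a table of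
tails in array `2`, the adjacency matrix in array `0`, and the limit for prefix sums. -/
def prepare : Stmt :=
  sizes ;; search ;;
  .assign 9 (.load (.reg 1 + 3 + .reg 0)) ;;
  .assign 13 (4 * .reg 2 * .reg 3 + 1) ;;
  .store (.cell 2 (.reg 0)) (.reg 4) ;;
  .store (.cell 0 (.cond (.lt (.reg 0) (2 * .reg 2)) (.reg 4 * .reg 1 + .reg 9)
    (.reg 1 * .reg 1 + .reg 0))) 1

/-- The state after the preparation, which all later phases up to the output preserve. -/
structure Ready {n P : ℕ} (G : SimpleGraph (Fin n)) [DecidableRel G.Adj] (M : ℕ → ℕ) (m s : ℕ)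
    (σ : St P) : Prop where
  idx : ∀ p, σ.V p 0 = p
  vertices : ∀ p, σ.V p 1 = n
  edges : ∀ p, σ.V p 2 = m
  block : ∀ p, σ.V p 3 = s
  tail : ∀ p : Fin P, (p : ℕ) < 2 * m → IsTail n M p (σ.V p 4)
  head : ∀ p : Fin P, (p : ℕ) < 2 * m → σ.V p 9 = M (n + 3 + p)
  lim : ∀ p, σ.V p 13 = 4 * m * s + 1
  low : ∀ a, a < n + 3 + 2 * m → σ.mem a = M a
  out : ∀ a, n + 3 + 2 * m ≤ a → a < 2 * n + 2 * m + 4 → σ.mem a = 0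
  zero : σ.mem (cell n m 1 0) = 0
  adj : ∀ a b, a < n → b < n → σ.mem (cell n m 0 (a * n + b)) = adjNat G a b
  tails : ∀ e, e < 2 * m → IsTail n M e (σ.mem (cell n m 2 e))

variable {n P : ℕ} {G : SimpleGraph (Fin n)} [DecidableRel G.Adj] {M : ℕ → ℕ} {m s : ℕ}

theorem mul_add_inj {a b a' b' : ℕ} (hb : b < n) (hb' : b' < n) (h : a * n + b = a' * n + b') :
    a = a' ∧ b = b' := by
  have hn : 0 < n := by omega
  have ha : a = a' := by
    have := congrArg (· / n) h
    simpa [Nat.mul_comm _ n, Nat.mul_add_div hn, Nat.div_eq_of_lt hb, Nat.div_eq_of_lt hb']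
      using this
  subst ha
  exact ⟨rfl, by omega⟩

theorem mul_add_lt {a b : ℕ} (ha : a < n) (hb : b < n) : a * n + b < n * n := by
  nlinarith

/-- The matrix may have more cells than there are processors, but it lies in memory that is
initially 0, so one write per arc completes it. -/
theorem prepare_spec {L : ℕ} {σ : St P} (hM : HoldsGraph G M) (hm : m = G.edgeFinset.card)
    (hm0 : 0 < m) (hmP : 8 * (m * Nat.sqrt m) ≤ P) (hL : n + 1 ≤ 2 ^ L) (hL' : m ≤ 2 ^ L)
    (h0 : ∀ p, σ.V p 0 = p) (hmem : σ.mem = M) :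
    Spec L prepare σ fun σ' =>
      ∃ s, 0 < s ∧ m ≤ s * s ∧ s ≤ 2 * Nat.sqrt m ∧ Ready G M m s σ' := by
  refine .seq (.weaken (sizes_spec hL' hm0 (by rw [hmem, hM.numVertices])
    (by rw [hmem, hM.numEdges, hm])) ?_)
  rintro σ₁ ⟨s, hs0, hs, hsq, h₁⟩
  refine .seq (.weaken (search_spec hL (fun p => by rw [h₁.idx, h0]) h₁.vertices) ?_)
  rintro σ₂ h₂
  have hmem₂ : σ₂.mem = M := by rw [h₂.mem, h₁.mem, hmem]
  have g0 : ∀ p, σ₂.V p 0 = p := fun p => by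
    rw [h₂.reg p 0 (by decide) (by decide) (by decide) (by decide) (by decide), h₁.idx, h0]
  have g1 : ∀ p, σ₂.V p 1 = n := fun p => by
    rw [h₂.reg p 1 (by decide) (by decide) (by decide) (by decide) (by decide), h₁.vertices]
  have g2 : ∀ p, σ₂.V p 2 = m := fun p => by
    rw [h₂.reg p 2 (by decide) (by decide) (by decide) (by decide) (by decide), h₁.edges]
  have g3 : ∀ p, σ₂.V p 3 = s := fun p => by
    rw [h₂.reg p 3 (by decide) (by decide) (by decide) (by decide) (by decide), h₁.block]
  have htail : ∀ p : Fin P, (p : ℕ) < 2 * m → IsTail n M p (σ₂.V p 4) := fun p hp => by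
    have := h₂.found p
    rw [h₁.mem, hmem, hM.offset_last, hM.offset_zero, ← hm] at this
    exact this (Nat.zero_le _) hp
  have h2m : 2 * m ≤ P := by
    have := Nat.sqrt_pos.2 hm0
    nlinarith
  refine .seq (.assign (by simp) (.seq (.assign (by simp) (.seq (.store (by simp) (by simp) ?_ ?_)))))
  · intro p q hpq
    simpa [g0, g1, g2, cell_inj, Fin.ext_iff] using hpq
  intro mem₃ hw₃
  simp only [Exp.eval_cell, Exp.eval_reg, St.set_V, St.set_mem, Fin.reduceEq, if_false,
    g0, g1, g2, hmem₂] at hw₃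
  have hhead : ∀ p : Fin P, (p : ℕ) < 2 * m → M (n + 3 + p) < n := fun p hp => by
    obtain ⟨w, hw, -⟩ := (htail p hp).exists_head hM
    rw [hw]; exact w.2
  -- Arcs use entries below `n * n`, distinct for distinct arcs; processors without an arc use
  -- entries from `n * n` on.
  have hinj : Function.Injective fun p : Fin P => if (p : ℕ) < 2 * m then
      σ₂.V p 4 * n + M (n + 3 + p) else n * n + p := by
    intro p q hpq
    simp only at hpq
    split_ifs at hpq with hp hq hq
    · obtain ⟨ht, hh⟩ := mul_add_inj (hhead p hp) (hhead q hq) hpq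
      exact Fin.ext ((htail p hp).head_inj hM (ht ▸ htail q hq) hh)
    · have := mul_add_lt (htail p hp).1 (hhead p hp)
      omega
    · have := mul_add_lt (htail q hq).1 (hhead q hq)
      omega
    · exact Fin.ext (by omega)
  refine .store (by simp) (by simp) ?_ ?_
  · intro p q hpq
    refine hinj ?_
    simpa [g0, g1, g2, hmem₂, cell_inj] using hpq
  intro mem₄ hw₄
  simp only [Exp.eval_cell, Exp.eval_cond_lt, Exp.eval_add, Exp.eval_mul, Exp.eval_load,
    Exp.eval_reg, Exp.eval_ofNat, St.set_V, St.set_mem, Fin.reduceEq, if_false, if_true,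
    g0, g1, g2, hmem₂] at hw₄
  have hlow : ∀ a, a < 2 * n + 2 * m + 4 → mem₄ a = M a := fun a ha => by
    rw [hw₄.2 a fun p => ?_, hw₃.2 a fun p => ?_] <;> dsimp only [cell] <;> omega
  refine ⟨s, hs0, hs, hsq, fun p => by simp [g0], fun p => by simp [g1], fun p => by simp [g2],
    fun p => by simp [g3], fun p hp => ?_, fun p hp => by simp [g0, g1, hmem₂],
    fun p => by simp [g2, g3], fun a ha => ?_, fun a ha ha' => ?_, ?_, fun a b ha hb => ?_,
    fun e he => ?_⟩
  · simpa using htail p hp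
  · exact hlow a (by omega)
  · exact (hlow a ha').trans (hM.rest a (by rw [← hm]; exact ha))
  · change mem₄ _ = 0
    rw [hw₄.2 _ fun p => ?_, hw₃.2 _ fun p => ?_, hM.rest _ ?_] <;> dsimp only [cell] <;> omega
  · change mem₄ _ = _
    by_cases hab : G.Adj ⟨a, ha⟩ ⟨b, hb⟩
    · obtain ⟨e, he, he'⟩ := hM.exists_arc hab
      have hem := he.lt hM
      rw [← hm] at hem
      have := hw₄.1 ⟨e, by omega⟩
      simp only at this
      rw [if_pos hem, (htail ⟨e, by omega⟩ hem).unique hM he, he'] at this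
      rw [this]
      simp [adjNat, ha, hb, hab]
    · rw [hw₄.2 _ fun p => ?_, hw₃.2 _ fun p => ?_, hM.rest _ ?_]
      · simp [adjNat, hab]
      · dsimp only [cell]; omega
      · dsimp only [cell]; omega
      · rw [Ne, cell_inj]
        split_ifs with hp
        · intro he
          obtain ⟨rfl, hh⟩ := mul_add_inj (hhead p hp) hb he
          obtain ⟨w, hw, hw'⟩ := (htail p hp).exists_head hM
          obtain rfl : w = ⟨b, hb⟩ := Fin.ext (by rw [← hw, hh])
          exact hab hw'
        · have := mul_add_lt ha hb
          omega
  · change IsTail n M e (mem₄ _)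
    rw [hw₄.2 _ fun p => by dsimp only [cell]; omega, hw₃.1 ⟨e, by omega⟩]
    exact htail ⟨e, by omega⟩ he

/-- Readiness depends on some of the variables only, and not on array `1`. -/
theorem Ready.congr {σ σ' : St P} (h : Ready G M m s σ)
    (hreg : ∀ p r, r ≠ 6 → r ≠ 7 → r ≠ 8 → r ≠ 10 → r ≠ 11 → r ≠ 12 → σ'.V p r = σ.V p r)
    (hmem : ∀ a, (∀ i, a ≠ cell n m 1 i) → σ'.mem a = σ.mem a)
    (hzero : σ'.mem (cell n m 1 0) = 0) : Ready G M m s σ' := by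
  have hr : ∀ r : Fin 16, r ≠ 6 ∧ r ≠ 7 ∧ r ≠ 8 ∧ r ≠ 10 ∧ r ≠ 11 ∧ r ≠ 12 →
      ∀ p, σ'.V p r = σ.V p r := fun r ⟨a, b, c, d, e, f⟩ p => hreg p r a b c d e f
  refine ⟨fun p => ?_, fun p => ?_, fun p => ?_, fun p => ?_, fun p => ?_, fun p => ?_,
    fun p => ?_, fun a ha => ?_, fun a ha ha' => ?_, hzero, fun a b ha hb => ?_, fun e he => ?_⟩
  · rw [hr 0 (by decide)]; exact h.idx p
  · rw [hr 1 (by decide)]; exact h.vertices p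
  · rw [hr 2 (by decide)]; exact h.edges p
  · rw [hr 3 (by decide)]; exact h.block p
  · rw [hr 4 (by decide)]; exact h.tail p
  · rw [hr 9 (by decide)]; exact h.head p
  · rw [hr 13 (by decide)]; exact h.lim p
  · rw [hmem a fun i => by unfold cell; omega]; exact h.low a ha
  · rw [hmem a fun i => by unfold cell; omega]; exact h.out a ha ha'
  · rw [hmem _ fun i => by unfold cell; omega]; exact h.adj a b ha hb
  · rw [hmem _ fun i => by unfold cell; omega]; exact h.tails e he

theorem Ready.set {σ : St P} (h : Ready G M m s σ) {r : Fin 16} (f : Fin P → ℕ)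
    (hr : r = 7 ∨ r = 10 ∨ r = 11 ∨ r = 12) : Ready G M m s (σ.set r f) := by
  refine h.congr (fun p r' h6 h7 h8 h10 h11 h12 => ?_) (fun a _ => rfl) h.zero
  rw [St.set_V, if_neg]
  rintro rfl
  tauto

theorem Scanned.ready {σ σ' : St P} {x : ℕ → ℕ} {lim : ℕ} (h : Scanned n m lim x σ σ')
    (hσ : Ready G M m s σ) : Ready G M m s σ' :=
  hσ.congr (fun p r h6 h7 h8 _ _ _ => h.reg p r h6 h7 h8) h.mem
    (by rw [h.sum 0 (Nat.zero_le _) (Nat.zero_le _), Finset.sum_range_zero])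

/-- In a ready state, put the values of an expression into variable `7` and scan them. -/
theorem Ready.scan {L : ℕ} {σ : St P} {e : Exp} {S : Stmt} {Q : St P → Prop}
    (h : Ready G M m s σ) (hL : 4 * m * s + 1 ≤ 2 ^ L) (hP : 4 * m * s ≤ P) (he : e.Small)
    (hQ : ∀ (x : ℕ → ℕ) σ', (∀ p : Fin P, x p = e.eval σ.mem (σ.V p)) → Ready G M m s σ' →
      (∀ p r, r ≠ 6 → r ≠ 7 → r ≠ 8 → σ'.V p r = σ.V p r) →
      (∀ i, i ≤ 4 * m * s → σ'.mem (cell n m 1 i) = ∑ l ∈ Finset.range i, x l) →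
      Spec L S σ' Q) :
    Spec L (.assign 7 e ;; PRAM.scan ;; S) σ Q := by
  refine .seq (.assign he ?_)
  have h' := h.set (fun p => e.eval σ.mem (σ.V p)) (.inl rfl)
  obtain ⟨x, hx⟩ : ∃ x : ℕ → ℕ, ∀ p : Fin P, x p = e.eval σ.mem (σ.V p) :=
    ⟨fun l => if hl : l < P then e.eval σ.mem (σ.V ⟨l, hl⟩) else 0, fun p => dif_pos p.2⟩
  refine .seq (.weaken (scan_spec x hL h'.idx h'.vertices h'.edges h'.lim
    (fun p => by rw [St.set_V, if_pos rfl, hx]) h'.zero) fun σ' hσ' => ?_)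
  refine hQ x σ' hx (hσ'.ready h') (fun p r h6 h7 h8 => ?_)
    fun i hi => hσ'.sum i (hi.trans hP) (by omega)
  rw [hσ'.reg p r h6 h7 h8, St.set_V, if_neg h7]

end PRAM

namespace PRAM

variable {n P : ℕ} {G : SimpleGraph (Fin n)} [DecidableRel G.Adj] {M : ℕ → ℕ} {m s : ℕ}

/-! ## Common neighbours of the endpoints of each arc -/

namespace Exp

/-- The offset of the adjacency array of a vertex. -/
def offset (v : Exp) : Exp := load (2 + v)

/-- The end of the adjacency array of a vertex. -/
def offsetEnd (v : Exp) : Exp := load (3 + v)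

/-- The entry of the adjacency arrays at a position. -/
def arc (e : Exp) : Exp := load (reg 1 + 3 + e)

/-- The entry of the adjacency matrix. -/
def adj (u v : Exp) : Exp := load (cell 0 (u * reg 1 + v))

/-- The entry of the array of prefix sums. -/
def prefixSum (i : Exp) : Exp := load (cell 1 i)

/-- The entry of the table of tails. -/
def tail (e : Exp) : Exp := load (cell 2 e)

/-- For the pair of an arc `e` and an index `i`: whether the `i`-th neighbour of the head of `e`
exists and is adjacent to the tail of `e`. -/
def lightPair (e i : Exp) : Exp :=
  cond (lt i (offsetEnd (arc e) - offset (arc e)))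
    (adj (arc (offset (arc e) + i)) (tail e)) 0

/-- For the pair of an index `k` and an arc `e`: whether the tail of the arc `k * s` is adjacent
to the head of `e`. -/
def heavyPair (k e : Exp) : Exp := adj (tail (k * reg 3)) (arc e)

/-- The remainder. -/
def mod (a b : Exp) : Exp := a - a / b * b

theorem eval_mod (mem : ℕ → ℕ) (V : Fin 16 → ℕ) (a b : Exp) :
    (mod a b).eval mem V = a.eval mem V % b.eval mem V := by
  rw [mod, eval_sub, eval_mul, eval_div, Nat.mod_eq_sub_div_mul]

/-- The quotient of `off v + s - 1` by `s`, for the head `v`, times the number of arcs. -/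
def bucket : Exp := (offset (reg 9) + reg 3 - 1) / reg 3 * (2 * reg 2)

end Exp

open Exp in
/-- Count the common neighbours of the ends of each arc, in variable `10`, provided that the head
is of degree less than `s`. -/
def countLight : Stmt :=
  .assign 7 (lightPair (reg 0 / (2 * reg 3)) (mod (reg 0) (2 * reg 3))) ;; scan ;;
  .assign 10 (prefixSum ((reg 0 + 1) * (2 * reg 3)) - prefixSum (reg 0 * (2 * reg 3)))

open Exp in
/-- Count the common neighbours of the ends of each arc, in variable `10`, for the other arcs. -/
def countHeavy : Stmt :=
  .assign 7 (heavyPair (reg 0 / (2 * reg 2)) (mod (reg 0) (2 * reg 2))) ;; scan ;;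
  .assign 10 (cond (lt (offsetEnd (reg 9) - offset (reg 9)) (reg 3)) (reg 10)
    (prefixSum (bucket + offsetEnd (reg 4)) - prefixSum (bucket + offset (reg 4))))

theorem sum_range_ite_lt {d N : ℕ} (h : d ≤ N) (f : ℕ → ℕ) :
    ∑ i ∈ Finset.range N, (if i < d then f i else 0) = ∑ i ∈ Finset.range d, f i := by
  rw [← Finset.sum_filter]
  congr 1
  ext i
  simp only [Finset.mem_filter, Finset.mem_range]
  omega

theorem sum_range_add_sub (x : ℕ → ℕ) (a b : ℕ) :
    ∑ i ∈ Finset.range (a + b), x i - ∑ i ∈ Finset.range a, x i =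
      ∑ i ∈ Finset.range b, x (a + i) := by
  rw [Finset.sum_range_add, Nat.add_sub_cancel_left]

section

variable {σ : St P} (h : Ready G M m s σ) (hM : HoldsGraph G M) (hm : m = G.edgeFinset.card)

include h

theorem Ready.offset_eq {v : ℕ} (hv : v ≤ n) : σ.mem (2 + v) = M (2 + v) := h.low _ (by omega)

theorem Ready.arc_eq {e : ℕ} (he : e < 2 * m) : σ.mem (n + 3 + e) = M (n + 3 + e) :=
  h.low _ (by omega)

include hM

theorem Ready.offsetEnd_eq (v : Fin n) : σ.mem (3 + v) = M (2 + (v : ℕ)) + G.degree v := by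
  rw [show 3 + (v : ℕ) = 2 + (v + 1) by omega, h.offset_eq v.2, hM.offset_succ]

include hm

theorem Ready.tails_eq {e v : ℕ} (he : IsTail n M e v) : σ.mem (cell n m 2 e) = v :=
  (h.tails e (by rw [hm]; exact he.lt hM)).unique hM he

theorem Ready.tail_eq {p : Fin P} {v : ℕ} (he : IsTail n M p v) : σ.V p 4 = v :=
  (h.tail p (by rw [hm]; exact he.lt hM)).unique hM he

end

theorem adjNat_comm (a b : ℕ) : adjNat G a b = adjNat G b a := by
  by_cases ha : a < n
  · by_cases hb : b < n
    · simp [adjNat, ha, hb, G.adj_comm ⟨a, ha⟩ ⟨b, hb⟩]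
    · simp [adjNat, hb]
  · simp [adjNat, ha]

/-- Processor `e * (2 * s) + i` tests the `i`-th neighbour of the head of `e`. A degree below `s`
fits into the block of `2 * s` processors, whose sum is a difference of two prefix sums. -/
theorem countLight_spec {L : ℕ} {σ : St P} (h : Ready G M m s σ) (hM : HoldsGraph G M)
    (hm : m = G.edgeFinset.card) (hs : 0 < s) (hL : 4 * m * s + 1 ≤ 2 ^ L) (hP : 4 * m * s ≤ P) :
    Spec L countLight σ fun σ' => Ready G M m s σ' ∧
      ∀ (p : Fin P) (u v : Fin n), IsTail n M p u → M (n + 3 + p) = v → G.degree v < s →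
        σ'.V p 10 = (G.neighborFinset u ∩ G.neighborFinset v).card := by
  refine h.scan hL hP (by simp [Exp.lightPair, Exp.offset, Exp.offsetEnd, Exp.arc, Exp.adj,
    Exp.tail, Exp.mod]) fun x σ' hx h' hreg hsum => ?_
  refine .assign (by simp [Exp.prefixSum]) ⟨h'.set _ (by simp), fun p u v hu hv hd => ?_⟩
  have hp : (p : ℕ) < 2 * m := by rw [hm]; exact hu.lt hM
  have hend : (p + 1) * (2 * s) ≤ 4 * m * s := by nlinarith
  have hend' : p * (2 * s) + 2 * s ≤ 4 * m * s := by nlinarith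
  rw [St.set_V, if_pos rfl]
  simp only [Exp.prefixSum, Exp.eval_cell, Exp.eval_add, Exp.eval_sub, Exp.eval_mul, Exp.eval_load,
    Exp.eval_reg, Exp.eval_ofNat, h'.idx, h'.vertices, h'.edges, h'.block]
  rw [hsum _ hend, hsum _ (by omega), add_mul, one_mul, sum_range_add_sub]
  have hval : ∀ i ∈ Finset.range (2 * s), x (p * (2 * s) + i) = if i < G.degree v then
      adjNat G (M (n + 3 + M (2 + (v : ℕ)) + i)) u else 0 := by
    intro i hi
    rw [Finset.mem_range] at hi
    have hdiv : (p * (2 * s) + i) / (2 * s) = p := by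
      rw [Nat.mul_comm, Nat.mul_add_div (by omega), Nat.div_eq_of_lt hi, add_zero]
    have hmod : (p * (2 * s) + i) % (2 * s) = i := by
      rw [Nat.mul_add_mod_self_right, Nat.mod_eq_of_lt hi]
    refine (hx ⟨p * (2 * s) + i, by omega⟩).trans ?_
    simp only [Exp.lightPair, Exp.offset, Exp.offsetEnd, Exp.arc, Exp.adj, Exp.tail,
      Exp.eval_cell, Exp.eval_cond_lt, Exp.eval_add, Exp.eval_sub, Exp.eval_mul, Exp.eval_div,
      Exp.eval_mod, Exp.eval_load, Exp.eval_reg, Exp.eval_ofNat, h.idx, h.vertices, h.edges,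
      h.block, hdiv, hmod, h.arc_eq hp, hv, h.offsetEnd_eq hM, h.offset_eq v.2.le,
      h.tails_eq hM hm hu, Nat.add_sub_cancel_left]
    split_ifs with hi'
    · have ht := hM.isTail v hi'
      obtain ⟨w, hw, -⟩ := ht.exists_head hM
      have hlt : M (2 + (v : ℕ)) + i < 2 * m := by rw [hm]; exact ht.lt hM
      rw [h.arc_eq hlt, h.adj _ _ (by rw [hw]; exact w.2) u.2, add_assoc (n + 3)]
    · rfl
  rw [Finset.sum_congr rfl hval, sum_range_ite_lt (by omega),
    hM.sum_arcs v fun w => adjNat G w u, sum_adjNat, Finset.inter_comm]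

/-- Among any `s` consecutive positions there is a multiple of `s`, so every vertex of degree at
least `s` is the tail of some arc `k * s`. Block `k` of the table then tells, for every arc, whether
its head is adjacent to that vertex; summing over the arcs of `u` counts common neighbours. -/
theorem countHeavy_spec {L : ℕ} {σ : St P} (h : Ready G M m s σ) (hM : HoldsGraph G M)
    (hm : m = G.edgeFinset.card) (hm0 : 0 < m) (hs : 0 < s) (hms : m ≤ s * s)
    (hL : 4 * m * s + 1 ≤ 2 ^ L) (hP : 4 * m * s ≤ P)
    (hlight : ∀ (p : Fin P) (u v : Fin n), IsTail n M p u → M (n + 3 + p) = v → G.degree v < s →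
        σ.V p 10 = (G.neighborFinset u ∩ G.neighborFinset v).card) :
    Spec L countHeavy σ fun σ' => Ready G M m s σ' ∧
      ∀ (p : Fin P) (u v : Fin n), IsTail n M p u → M (n + 3 + p) = v →
        σ'.V p 10 = (G.neighborFinset u ∩ G.neighborFinset v).card := by
  refine h.scan hL hP (by simp [Exp.heavyPair, Exp.arc, Exp.adj, Exp.tail, Exp.mod]) fun x σ' hx h' hreg hsum => ?_
  refine .assign (by simp [Exp.prefixSum, Exp.offset, Exp.offsetEnd, Exp.bucket])
    ⟨h'.set _ (by simp), fun p u v hu hv => ?_⟩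
  have hp : (p : ℕ) < 2 * m := by rw [hm]; exact hu.lt hM
  rw [St.set_V, if_pos rfl]
  have hhead : σ'.V p 9 = v := by rw [h'.head p hp, hv]
  simp only [Exp.prefixSum, Exp.offset, Exp.offsetEnd, Exp.bucket, Exp.eval_cond_lt, Exp.eval_cell,
    Exp.eval_add, Exp.eval_sub, Exp.eval_mul, Exp.eval_div, Exp.eval_load, Exp.eval_reg,
    Exp.eval_ofNat, hhead, h'.tail_eq hM hm hu, h'.vertices, h'.edges, h'.block,
    h'.offsetEnd_eq hM, h'.offset_eq v.2.le, h'.offset_eq u.2.le, Nat.add_sub_cancel_left]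
  split_ifs with hd
  · rw [hreg p 10 (by decide) (by decide) (by decide)]
    exact hlight p u v hu hv hd
  -- Division rounded up: `k * s` is the first multiple of `s` not before the adjacency array of
  -- `v`.
  set k := (M (2 + (v : ℕ)) + s - 1) / s with hk
  have hk1 : M (2 + (v : ℕ)) ≤ k * s := by
    have := Nat.lt_div_mul_add (a := M (2 + (v : ℕ)) + s - 1) hs
    rw [← hk] at this
    omega
  have hk2 : k * s < M (2 + (v : ℕ)) + s := by
    have := Nat.div_mul_le_self (M (2 + (v : ℕ)) + s - 1) s
    rw [← hk] at this
    omega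
  have htail : IsTail n M (k * s) v := ⟨v.2, hk1, by rw [hM.offset_succ]; omega⟩
  have hks : k * s < 2 * m := by rw [hm]; exact htail.lt hM
  -- Here `m ≤ s * s` is used: `k * s < 2 * m ≤ 2 * s * s`.
  have hk3 : k < 2 * s := by
    by_contra hcon
    have := Nat.mul_le_mul_right s (not_lt.1 hcon)
    nlinarith
  have hu2 : M (2 + (u : ℕ)) + G.degree u ≤ 2 * m := by
    rw [← hM.offset_succ, hm, ← hM.offset_last]
    exact hM.offset_mono u.2 le_rfl
  have hend : k * (2 * m) + 2 * m ≤ 4 * m * s := by nlinarith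
  rw [hsum _ (by omega), hsum _ (by omega), ← add_assoc, sum_range_add_sub]
  have hval : ∀ i ∈ Finset.range (G.degree u), x (k * (2 * m) + M (2 + (u : ℕ)) + i) =
      adjNat G (M (n + 3 + M (2 + (u : ℕ)) + i)) v := by
    intro i hi
    rw [Finset.mem_range] at hi
    have hlt : M (2 + (u : ℕ)) + i < 2 * m := by omega
    have hdiv : (k * (2 * m) + M (2 + (u : ℕ)) + i) / (2 * m) = k := by
      rw [add_assoc, Nat.mul_comm, Nat.mul_add_div (by omega), Nat.div_eq_of_lt hlt, add_zero]
    have hmod : (k * (2 * m) + M (2 + (u : ℕ)) + i) % (2 * m) = M (2 + (u : ℕ)) + i := by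
      rw [add_assoc, Nat.mul_add_mod_self_right, Nat.mod_eq_of_lt hlt]
    obtain ⟨w, hw, -⟩ := (hM.isTail u hi).exists_head hM
    refine (hx ⟨k * (2 * m) + M (2 + (u : ℕ)) + i, by omega⟩).trans ?_
    simp only [Exp.heavyPair, Exp.arc, Exp.adj, Exp.tail, Exp.eval_cell, Exp.eval_add,
      Exp.eval_mul, Exp.eval_div, Exp.eval_mod, Exp.eval_load, Exp.eval_reg, Exp.eval_ofNat,
      h.idx, h.vertices, h.edges, h.block, hdiv, hmod, h.arc_eq hlt, h.tails_eq hM hm htail]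
    rw [h.adj _ _ v.2 (by rw [hw]; exact w.2), adjNat_comm, add_assoc (n + 3)]
  rw [Finset.sum_congr rfl hval, hM.sum_arcs u fun w => adjNat G w v, sum_adjNat]

end PRAM

namespace PRAM

variable {n P : ℕ} {G : SimpleGraph (Fin n)} [DecidableRel G.Adj] {M : ℕ → ℕ} {m s : ℕ}

/-! ## Triangle counts, centralities, and the output -/

open TriangleCentrality

/-- The sum of the scanned values over the adjacency array of a vertex. -/
def Exp.rowSum (v : Exp) : Exp := .prefixSum (.offsetEnd v) - .prefixSum (.offset v)

/-- From the numbers of common neighbours in variable `10`, compute six times the number of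
triangles in variable `12`, and in variable `11` the numerator of the centrality of the tail. -/
def combine : Stmt :=
  .assign 7 (.reg 10) ;; scan ;;
  .assign 11 (.rowSum (.reg 4)) ;;
  .assign 12 (.prefixSum (2 * .reg 2)) ;;
  .assign 7 (.cond (.lt 0 (.reg 10)) 1 3 * .rowSum (.reg 9)) ;; scan ;;
  .assign 11 (.reg 11 + .rowSum (.reg 4))

/-- Write the output. -/
def output : Stmt :=
  .store (.cond (.lt (.reg 0) 1) (.reg 1 + 3 + 2 * .reg 2) (.cell 3 (.reg 0))) (.reg 12) ;;
  .store (.cond (.lt (.reg 0) (2 * .reg 2))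
    (.cond (.lt (.offset (.reg 4)) (.reg 0)) (.cell 3 (.reg 0))
      (.reg 1 + 4 + 2 * .reg 2 + .reg 4)) (.cell 3 (.reg 0))) (.reg 11)

/-- The numerator of the triangle centrality, over six times the number of triangles. -/
def numerator (G : SimpleGraph (Fin n)) [DecidableRel G.Adj] (v : Fin n) : ℕ :=
  2 * trianglesAt G v + ∑ w ∈ G.neighborFinset v,
    (if (G.neighborFinset v ∩ G.neighborFinset w).card = 0 then 3 else 1) * (2 * trianglesAt G w)

theorem HoldsGraph.offset_add_degree_le (hM : HoldsGraph G M) (v : Fin n) :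
    M (2 + (v : ℕ)) + G.degree v ≤ 2 * G.edgeFinset.card := by
  rw [← hM.offset_succ, ← hM.offset_last]
  exact hM.offset_mono v.2 le_rfl

/-- The value of `rowSum` after a scan of values that depend on the tail and the head of the arc. -/
theorem Ready.rowSum_eq {σ : St P} (h : Ready G M m s σ) (hM : HoldsGraph G M)
    (hm : m = G.edgeFinset.card) {N : ℕ} (hN : 2 * m ≤ N) {x : ℕ → ℕ}
    (hsum : ∀ i, i ≤ N → σ.mem (cell n m 1 i) = ∑ l ∈ Finset.range i, x l)
    {f : Fin n → Fin n → ℕ}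
    (hx : ∀ (e : ℕ) (u v : Fin n), IsTail n M e u → M (n + 3 + e) = v → x e = f u v)
    {p : Fin P} {v : Exp} {u : Fin n} (hv : v.eval σ.mem (σ.V p) = u) :
    (Exp.rowSum v).eval σ.mem (σ.V p) = ∑ w ∈ G.neighborFinset u, f u w := by
  simp only [Exp.rowSum, Exp.prefixSum, Exp.offset, Exp.offsetEnd, Exp.eval_sub, Exp.eval_load,
    Exp.eval_cell, Exp.eval_add, Exp.eval_ofNat, hv, h.vertices, h.edges, h.offsetEnd_eq hM,
    h.offset_eq u.2.le]
  have hle := hM.offset_add_degree_le u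
  rw [← hm] at hle
  rw [hsum _ (by omega), hsum _ (by omega), sum_range_add_sub]
  have hval : ∀ i ∈ Finset.range (G.degree u), x (M (2 + (u : ℕ)) + i) =
      (fun a => if ha : a < n then f u ⟨a, ha⟩ else 0) (M (n + 3 + M (2 + (u : ℕ)) + i)) := by
    intro i hi
    have ht := hM.isTail u (Finset.mem_range.1 hi)
    obtain ⟨w, hw, -⟩ := ht.exists_head hM
    rw [hx _ u w ht hw, add_assoc (n + 3), hw]
    simp
  rw [Finset.sum_congr rfl hval, hM.sum_arcs u fun a => if ha : a < n then f u ⟨a, ha⟩ else 0]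
  simp

/-- Row sums of the first scan give twice the triangle count at any vertex. They are read for the
tail and for the head of each arc before the second scan overwrites the array; the second scan adds
the weighted counts of the heads over each row. -/
theorem combine_spec {L : ℕ} {σ : St P} (h : Ready G M m s σ) (hM : HoldsGraph G M)
    (hm : m = G.edgeFinset.card) (hs : 0 < s) (hL : 4 * m * s + 1 ≤ 2 ^ L) (hP : 4 * m * s ≤ P)
    (hcount : ∀ (p : Fin P) (u v : Fin n), IsTail n M p u → M (n + 3 + p) = v →
        σ.V p 10 = (G.neighborFinset u ∩ G.neighborFinset v).card) :
    Spec L combine σ fun σ' => Ready G M m s σ' ∧ (∀ p, σ'.V p 12 = 6 * triangles G) ∧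
      ∀ (p : Fin P) (u : Fin n), IsTail n M p u → σ'.V p 11 = numerator G u := by
  have hms : 2 * m ≤ 4 * m * s := by nlinarith
  refine h.scan hL hP (by simp) fun x σ₁ hx h₁ hreg₁ hsum₁ => ?_
  have hx' : ∀ (e : ℕ) (u v : Fin n), IsTail n M e u → M (n + 3 + e) = v →
      x e = (G.neighborFinset u ∩ G.neighborFinset v).card := fun e u v he hv => by
    have hlt := he.lt hM
    rw [← hm] at hlt
    rw [← hcount ⟨e, by omega⟩ u v he hv]
    exact hx ⟨e, by omega⟩
  have htri : ∀ (p : Fin P) (v : Exp) (u : Fin n), v.eval σ₁.mem (σ₁.V p) = u →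
      (Exp.rowSum v).eval σ₁.mem (σ₁.V p) = 2 * trianglesAt G u := fun p v u hv => by
    rw [h₁.rowSum_eq hM hm hms hsum₁ hx' hv, sum_common_neighbors]
  refine .seq (.assign (by simp [Exp.rowSum, Exp.prefixSum, Exp.offset, Exp.offsetEnd]) ?_)
  refine .seq (.assign (by simp [Exp.prefixSum]) ?_)
  set σ₂ : St P := (σ₁.set 11 _).set 12 _ with hσ₂
  have h₂ : Ready G M m s σ₂ := (h₁.set _ (by simp)).set _ (by simp)
  have htotal : ∀ p, σ₂.V p 12 = 6 * triangles G := fun p => by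
    simp only [hσ₂, St.set_V, if_true, St.set_mem, Exp.prefixSum, Exp.eval_load, Exp.eval_cell,
      Exp.eval_mul, Exp.eval_ofNat, Exp.eval_reg, Fin.reduceEq, if_false, h₁.vertices, h₁.edges]
    rw [hsum₁ _ hms, hm, hM.sum_all]
    have hrow : ∀ u : Fin n, ∑ i ∈ Finset.range (G.degree u), x (M (2 + (u : ℕ)) + i) =
        2 * trianglesAt G u := fun u => by
      have hle := hM.offset_add_degree_le u
      rw [← hm] at hle
      -- A constant expression makes the row sum of an arbitrary vertex available, independently of
      -- the arc of processor `p`.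
      have := htri p (.const u) u rfl
      simp only [Exp.rowSum, Exp.prefixSum, Exp.offset, Exp.offsetEnd, Exp.eval_sub,
        Exp.eval_load, Exp.eval_cell, Exp.eval_add, Exp.eval_ofNat, Exp.eval_const, h₁.vertices,
        h₁.edges, h₁.offsetEnd_eq hM, h₁.offset_eq u.2.le] at this
      rwa [hsum₁ _ (by omega), hsum₁ _ (by omega), sum_range_add_sub] at this
    rw [Finset.sum_congr rfl fun u _ => hrow u, ← Finset.mul_sum, sum_trianglesAt]
    omega
  have htail : ∀ (p : Fin P) (u : Fin n), IsTail n M p u → σ₂.V p 11 = 2 * trianglesAt G u :=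
    fun p u hu => by
      simp only [hσ₂, St.set_V, if_true, Fin.reduceEq, if_false]
      exact htri p (.reg 4) u (h₁.tail_eq hM hm hu)
  refine h₂.scan hL hP (by simp [Exp.rowSum, Exp.prefixSum, Exp.offset, Exp.offsetEnd])
    fun y σ₃ hy h₃ hreg₃ hsum₃ => ?_
  have hy' : ∀ (e : ℕ) (u v : Fin n), IsTail n M e u → M (n + 3 + e) = v →
      y e = (if (G.neighborFinset u ∩ G.neighborFinset v).card = 0 then 3 else 1) *
        (2 * trianglesAt G v) := fun e u v he hv => by
    have hlt := he.lt hM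
    rw [← hm] at hlt
    have hrow := h₂.rowSum_eq (v := .reg 9) (p := ⟨e, by omega⟩) hM hm hms hsum₁ hx'
      (by rw [Exp.eval_reg, h₂.head _ hlt, hv])
    have hten : σ₂.V ⟨e, by omega⟩ 10 = (G.neighborFinset u ∩ G.neighborFinset v).card := by
      rw [← hcount ⟨e, by omega⟩ u v he hv]
      simp only [hσ₂, St.set_V, Fin.reduceEq, if_false]
      exact hreg₁ _ _ (by decide) (by decide) (by decide)
    refine (hy ⟨e, by omega⟩).trans ?_
    rw [Exp.eval_mul, hrow, sum_common_neighbors, Exp.eval_cond_lt]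
    simp only [Exp.eval_ofNat, Exp.eval_reg, hten]
    congr 1
    split_ifs <;> omega
  refine .assign (by simp [Exp.rowSum, Exp.prefixSum, Exp.offset, Exp.offsetEnd])
    ⟨h₃.set _ (by simp), fun p => ?_, fun p u hu => ?_⟩
  · rw [St.set_V, if_neg (by decide), hreg₃ p 12 (by decide) (by decide) (by decide), htotal]
  · rw [St.set_V, if_pos rfl, Exp.eval_add, Exp.eval_reg,
      hreg₃ p 11 (by decide) (by decide) (by decide), htail p u hu,
      h₃.rowSum_eq hM hm hms hsum₃ hy' (v := .reg 4) (h₃.tail_eq hM hm hu), numerator]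

/-- An isolated vertex has no arc, hence no processor to write its result; the initial 0 in its
output cell is already correct. -/
theorem numerator_of_degree_eq_zero {v : Fin n} (h : G.degree v = 0) : numerator G v = 0 := by
  have hN : G.neighborFinset v = ∅ := by
    rw [← Finset.card_eq_zero, G.card_neighborFinset_eq_degree, h]
  have := sum_common_neighbors G v
  rw [hN, Finset.sum_empty] at this
  rw [numerator, hN, Finset.sum_empty, ← this, add_zero]

/-- All arcs of a vertex know its numerator; only the first one writes it, and every other processor
writes to its own entry of the scratch array 3. -/
theorem output_spec {L : ℕ} {σ : St P} (h : Ready G M m s σ) (hM : HoldsGraph G M)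
    (hm : m = G.edgeFinset.card) (hm0 : 0 < m) (hP : 2 * m ≤ P) {D : ℕ}
    (hD : ∀ p, σ.V p 12 = D)
    (hN : ∀ (p : Fin P) (u : Fin n), IsTail n M p u → σ.V p 11 = numerator G u) :
    Spec L output σ fun σ' => σ'.mem (n + 3 + 2 * m) = D ∧
      ∀ v : Fin n, σ'.mem (n + 3 + 2 * m + 1 + v) = numerator G v := by
  refine .seq (.store (by simp) (by simp) ?_ ?_)
  · intro p q hpq
    simp only [Exp.eval_cond_lt, Exp.eval_cell, Exp.eval_add, Exp.eval_mul, Exp.eval_reg,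
      Exp.eval_ofNat, h.idx, h.vertices, h.edges, cell] at hpq
    apply Fin.ext
    split_ifs at hpq <;> omega
  intro mem₁ hw₁
  simp only [Exp.eval_cond_lt, Exp.eval_cell, Exp.eval_add, Exp.eval_mul, Exp.eval_reg,
    Exp.eval_ofNat, h.idx, h.vertices, h.edges, hD] at hw₁
  have hD₁ : mem₁ (n + 3 + 2 * m) = D := by
    simpa using hw₁.1 ⟨0, by omega⟩
  have hlow : ∀ a, a < 2 * n + 2 * m + 4 → a ≠ n + 3 + 2 * m → mem₁ a = σ.mem a :=
    fun a ha ha' => hw₁.2 a fun p => by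
      dsimp only [cell]
      split_ifs <;> omega
  have hoff : ∀ p : Fin P, (p : ℕ) < 2 * m → mem₁ (2 + σ.V p 4) = M (2 + σ.V p 4) := fun p hp => by
    have := (h.tail p hp).1
    rw [hlow _ (by omega) (by omega), h.offset_eq this.le]
  -- The offset of the tail never exceeds the position of the arc, so failure of the strict
  -- inequality means that the arc is the first of its row.
  have haddr : ∀ p : Fin P, ((Exp.cond (.lt (.reg 0) (2 * .reg 2))
      (.cond (.lt (.offset (.reg 4)) (.reg 0)) (.cell 3 (.reg 0))
        (.reg 1 + 4 + 2 * .reg 2 + .reg 4)) (.cell 3 (.reg 0))).eval mem₁ (σ.V p)) =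
      if (p : ℕ) < 2 * m ∧ M (2 + σ.V p 4) = p then n + 4 + 2 * m + σ.V p 4
        else cell n m 3 p := fun p => by
    simp only [Exp.eval_cond_lt, Exp.eval_cell, Exp.eval_add, Exp.eval_mul, Exp.eval_reg,
      Exp.eval_load, Exp.eval_ofNat, Exp.offset, h.idx, h.vertices, h.edges]
    by_cases hp : (p : ℕ) < 2 * m
    · have := (h.tail p hp).2.1
      rw [hoff p hp, if_pos hp]
      split_ifs <;> omega
    · rw [if_neg hp, if_neg (fun hc => hp hc.1)]
  refine .store (by simp [Exp.offset]) (by simp) ?_ ?_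
  · intro p q hpq
    simp only [haddr] at hpq
    apply Fin.ext
    split_ifs at hpq with hp hq hq
    · rw [← hp.2, ← hq.2, show σ.V p 4 = σ.V q 4 by omega]
    · have := (h.tail p hp.1).1
      unfold cell at hpq
      omega
    · have := (h.tail q hq.1).1
      unfold cell at hpq
      omega
    · exact cell_inj.1 hpq
  intro mem₂ hw₂
  simp only [haddr, Exp.eval_reg] at hw₂
  refine ⟨?_, fun v => ?_⟩
  · rw [← hD₁]
    refine hw₂.2 _ fun p => ?_
    dsimp only [cell]
    split_ifs <;> omega
  change mem₂ _ = _
  rcases Nat.eq_zero_or_pos (G.degree v) with hv | hv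
  · rw [numerator_of_degree_eq_zero hv, hw₂.2 _ fun p => ?_, hlow _ (by omega) (by omega),
      h.out _ (by omega) (by omega)]
    dsimp only [cell]
    split_ifs with hp
    · intro he
      obtain ⟨i, hi, -⟩ := (h.tail p hp.1).exists_index hM
      have hpv : (⟨σ.V p 4, (h.tail p hp.1).1⟩ : Fin n) = v := Fin.ext (by simp only; omega)
      rw [hpv] at hi
      omega
    · omega
  · have ht : IsTail n M (M (2 + (v : ℕ))) v := hM.isTail v hv
    have hlt := ht.lt hM
    rw [← hm] at hlt
    have htail := h.tail_eq (p := ⟨M (2 + (v : ℕ)), by omega⟩) hM hm ht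
    have := hw₂.1 ⟨M (2 + (v : ℕ)), by omega⟩
    simp only [htail, hlt, true_and, if_true] at this
    rw [hN ⟨M (2 + (v : ℕ)), by omega⟩ v ht] at this
    rw [← this]
    congr 1
    omega

/-! ## The whole program -/

/-- The program for triangle centrality. -/
def centrality : Stmt := prepare ;; countLight ;; countHeavy ;; combine ;; output

theorem centrality_spec {L : ℕ} {σ : St P} (hM : HoldsGraph G M) (hm : m = G.edgeFinset.card)
    (hm0 : 0 < m) (hmP : 8 * (m * Nat.sqrt m) ≤ P) (hL : n + 1 ≤ 2 ^ L)
    (hL' : 8 * (m * Nat.sqrt m) + 1 ≤ 2 ^ L) (h0 : ∀ p, σ.V p 0 = p) (hmem : σ.mem = M) :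
    Spec L centrality σ fun σ' => σ'.mem (n + 3 + 2 * m) = 6 * triangles G ∧
      ∀ v : Fin n, σ'.mem (n + 3 + 2 * m + 1 + v) = numerator G v := by
  have hsqrt : 0 < Nat.sqrt m := Nat.sqrt_pos.2 hm0
  have hmm : m ≤ m * Nat.sqrt m := Nat.le_mul_of_pos_right m hsqrt
  refine .seq (.weaken (prepare_spec hM hm hm0 hmP hL (by omega) h0 hmem) ?_)
  rintro σ₁ ⟨s, hs0, hms, hsq, h₁⟩
  -- The source of the factor 8 in the number of processors: `s ≤ 2 * Nat.sqrt m`.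
  have h4 : 4 * m * s ≤ 8 * (m * Nat.sqrt m) := by nlinarith
  have hL₁ : 4 * m * s + 1 ≤ 2 ^ L := by omega
  have hP₁ : 4 * m * s ≤ P := by omega
  refine .seq (.weaken (countLight_spec h₁ hM hm hs0 hL₁ hP₁) ?_)
  rintro σ₂ ⟨h₂, hc₂⟩
  refine .seq (.weaken (countHeavy_spec h₂ hM hm hm0 hs0 hms hL₁ hP₁ hc₂) ?_)
  rintro σ₃ ⟨h₃, hc₃⟩
  refine .seq (.weaken (combine_spec h₃ hM hm hs0 hL₁ hP₁ hc₃) ?_)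
  rintro σ₄ ⟨h₄, hD, hN⟩
  exact output_spec h₄ hM hm hm0 (by omega) hD hN

theorem HoldsGraph.lt_cube (hM : HoldsGraph G M) (a : ℕ) : M a < (n + 2) ^ 3 := by
  have hcard : 2 * G.edgeFinset.card ≤ n * n := by
    rw [← G.sum_degrees_eq_twice_card_edges]
    calc ∑ v, G.degree v ≤ ∑ _v : Fin n, n := Finset.sum_le_sum fun v _ => by
          have := G.degree_lt_card_verts v
          rw [Fintype.card_fin] at this
          exact this.le
      _ = n * n := by simp
  have hn : n * n + n + 2 < (n + 2) ^ 3 := by nlinarith [Nat.zero_le (n ^ 3), Nat.zero_le (n ^ 2)]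
  rcases Nat.lt_or_ge a 2 with h2 | h2
  · rcases (show a = 0 ∨ a = 1 by omega) with rfl | rfl
    · rw [hM.numVertices]; omega
    · rw [hM.numEdges]; omega
  rcases Nat.lt_or_ge a (n + 3) with h3 | h3
  · obtain ⟨v, rfl⟩ := Nat.exists_eq_add_of_le h2
    have := hM.offset_mono (a := v) (b := n) (by omega) le_rfl
    rw [hM.offset_last] at this
    omega
  rcases Nat.lt_or_ge a (n + 3 + 2 * G.edgeFinset.card) with h4 | h4
  · obtain ⟨e, rfl⟩ := Nat.exists_eq_add_of_le h3
    -- If no row contained `e`, all offsets would by induction be at most `e`, including the last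
    -- one, `2 * m`.
    obtain ⟨v, i, hi, rfl⟩ : ∃ (v : Fin n) (i : ℕ), i < G.degree v ∧ e = M (2 + (v : ℕ)) + i := by
      by_contra! hcon
      have : ∀ k, k ≤ n → M (2 + k) ≤ e := fun k hk => by
        induction k with
        | zero => rw [add_zero, hM.offset_zero]; exact Nat.zero_le e
        | succ k ih =>
          have h5 := ih (by omega)
          have h6 := hcon ⟨k, hk⟩ (e - M (2 + k))
          rw [hM.offset_succ ⟨k, hk⟩]
          simp only at h6 ⊢
          by_contra h7
          exact h6 (by omega) (by omega)
      have := this n le_rfl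
      rw [hM.offset_last] at this
      omega
    obtain ⟨w, hw, -⟩ := (hM.isTail v hi).exists_head hM
    rw [hw]
    have := w.2
    omega
  · rw [hM.rest a h4]
    positivity

end PRAM

/-! ### Bounds in terms of the number of vertices, and the main theorem -/

namespace PRAM

open TriangleCentrality

/-- With `c` the rounded-up logarithm, `2 ^ (c - 1) < n + 2 ≤ n ^ 2` bounds `c - 1` by twice the
binary logarithm of `n`; the missing 1 is at most one more such logarithm. -/
theorem clog_le_log {n : ℕ} (hn : 2 ≤ n) :
    (Nat.clog 2 (n + 2) : ℝ) ≤ 3 / Real.log 2 * Real.log n := by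
  have h2 : 0 < Real.log 2 := Real.log_pos one_lt_two
  have hpow : 2 ^ (Nat.clog 2 (n + 2) - 1) ≤ n ^ 2 := by
    have := Nat.pow_pred_clog_lt_self (b := 2) one_lt_two (x := n + 2) (by omega)
    rw [Nat.pred_eq_sub_one] at this
    nlinarith
  have hlog : ((Nat.clog 2 (n + 2) - 1 : ℕ) : ℝ) * Real.log 2 ≤ 2 * Real.log n := by
    have h : ((2 : ℝ) ^ (Nat.clog 2 (n + 2) - 1)) ≤ (n : ℝ) ^ 2 := by exact_mod_cast hpow
    have := Real.log_le_log (by positivity) h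
    rwa [Real.log_pow, Real.log_pow, Nat.cast_ofNat] at this
  have hn2 : Real.log 2 ≤ Real.log n := Real.log_le_log two_pos (by exact_mod_cast hn)
  have hle : (Nat.clog 2 (n + 2) : ℝ) ≤ ((Nat.clog 2 (n + 2) - 1 : ℕ) : ℝ) + 1 := by
    exact_mod_cast (show Nat.clog 2 (n + 2) ≤ Nat.clog 2 (n + 2) - 1 + 1 by omega)
  rw [div_mul_eq_mul_div, le_div_iff₀ h2]
  nlinarith

/-- There is a program for triangle centrality with a logarithmic number of steps and a polynomial
growth of numbers. -/
theorem exists_centrality_program : ∃ (S : Stmt) (d c : ℕ), 0 < d ∧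
    ∀ (n : ℕ) (G : SimpleGraph (Fin n)) [DecidableRel G.Adj] (m P : ℕ) (M : ℕ → ℕ) (L b : ℕ),
      HoldsGraph G M → m = G.edgeFinset.card → 0 < m → 8 * (m * Nat.sqrt m) ≤ P →
      n + 1 ≤ 2 ^ L → 8 * (m * Nat.sqrt m) + 1 ≤ 2 ^ L → 1 ≤ L → 16 ≤ b → (∀ a, M a < b) →
      P < b → ∃ (σ : St P) (T : ℕ), T ≤ c * L ∧
        Run (b ^ d) S ⟨fun p r => if r = 0 then (p : ℕ) else 0, M⟩ T σ ∧
        σ.mem (n + 3 + 2 * m) = 6 * triangles G ∧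
        ∀ v : Fin n, σ.mem (n + 3 + 2 * m + 1 + v) = numerator G v := by
  refine ⟨centrality, centrality.deg, centrality.time 1, centrality.deg_pos, ?_⟩
  intro n G _ m P M L b hM hm hm0 hmP hL hL' hL1 hb hMb hPb
  obtain ⟨σ, T, hT, hrun, -, hQ⟩ := centrality_spec (P := P) hM hm hm0 hmP hL hL'
    (σ := ⟨fun p r => if r = 0 then (p : ℕ) else 0, M⟩) (fun p => rfl) rfl b hb
    ⟨hMb, fun p r => by
      have := p.2
      simp only
      split_ifs <;> omega⟩
  exact ⟨σ, T, hT.trans (centrality.time_le hL1), hrun, hQ⟩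

end PRAM

theorem mainTheorem5 :
    ∃ (prog : List PRAM.Instr) (C : ℝ) (K w : ℕ),
      ∀ (n : ℕ) (G : SimpleGraph (Fin n)) [DecidableRel G.Adj] (m P : ℕ) (M : ℕ → ℕ),
        m = G.edgeFinset.card →
        -- the number of processors
        P = K * (m * Nat.sqrt m) →
        PRAM.HoldsGraph G M →
        -- the machine obeys the CREW rule and uses words of `O(log n)` bits
        (∀ t : ℕ, (PRAM.run prog P M t).ExclusiveWrite prog) ∧
        (∀ t : ℕ, (PRAM.run prog P M t).Below ((n + 2) ^ w)) ∧
        -- it halts in time `O(log n)`, with the triangle centralities as output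
        ∃ T : ℕ, (T : ℝ) ≤ C * Real.log n ∧
          (PRAM.run prog P M T).Halted prog ∧
          (0 < TriangleCentrality.triangles G →
            PRAM.HoldsFractions (TriangleCentrality.TC G) (n + 3 + 2 * m)
              (PRAM.run prog P M T).mem) := by
  open PRAM TriangleCentrality in
  obtain ⟨S, d, c, hd, hS⟩ := exists_centrality_program
  -- The initial data and `P` are below `(n + 2) ^ 8`, which the program raises to the power `d`;
  -- each loop makes at most `8 * Nat.clog 2 (n + 2)` rounds.
  refine ⟨S.code 0, c * 8 * (3 / Real.log 2), 8, 8 * d, ?_⟩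
  intro n G _ m P M hm hP hM
  have hbase : (n + 2) ^ 8 ≤ (n + 2) ^ (8 * d) :=
    Nat.pow_le_pow_right (by omega) (Nat.le_mul_of_pos_right 8 hd)
  have hMb : ∀ a, M a < (n + 2) ^ 8 := fun a =>
    (hM.lt_cube a).trans_le (Nat.pow_le_pow_right (by omega) (by omega))
  have hC : (0 : ℝ) ≤ c * 8 := by positivity
  have h3 : 0 ≤ 3 / Real.log 2 := div_nonneg (by norm_num) (Real.log_nonneg one_le_two)
  -- Without edges there are no processors and no triangles. Time 0 is needed here, since `Real.log
  -- n` vanishes for `n ≤ 1`.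
  rcases Nat.eq_zero_or_pos m with hm0 | hm0
  · obtain rfl : P = 0 := by rw [hP, hm0, Nat.zero_mul, Nat.mul_zero]
    have hmem : ∀ t, (run (S.code 0) 0 M t).mem = M := fun t => by
      induction t with
      | zero => rfl
      | succ t ih =>
        rw [run, Function.iterate_succ_apply', Config.step, nextMem_of_none fun p => p.elim0]
        exact ih
    refine ⟨fun t p => p.elim0, fun t => ⟨fun a => ?_, fun p => p.elim0⟩, 0, ?_,
      fun p => p.elim0, fun htri => ?_⟩
    · rw [hmem]
      exact (hMb a).trans_le hbase
    · rw [Nat.cast_zero]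
      exact mul_nonneg (mul_nonneg hC h3) (Real.log_natCast_nonneg n)
    · have hbot : G = ⊥ := by
        rw [← SimpleGraph.edgeFinset_eq_empty, ← Finset.card_eq_zero, ← hm, hm0]
      subst hbot
      obtain ⟨s, hs⟩ := Finset.card_pos.1 htri
      rw [SimpleGraph.mem_cliqueFinset_iff, SimpleGraph.is3Clique_iff] at hs
      obtain ⟨a, b, c, hab, -⟩ := hs
      exact hab.elim
  have hn : 2 ≤ n := by
    obtain ⟨e, he⟩ := Finset.card_pos.1 (hm ▸ hm0)
    induction e with
    | _ u v =>
      have hne : u ≠ v := (SimpleGraph.mem_edgeFinset.1 he).ne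
      have := u.2
      have := v.2
      have : (u : ℕ) ≠ v := fun h => hne (Fin.ext h)
      omega
  have hmn : m < (n + 2) ^ 3 := by
    have := hM.lt_cube 1
    rwa [hM.numEdges, ← hm] at this
  -- Six of the eight factors `n + 2` bound `m * m`; the other two give at least 16, which absorbs
  -- the constants.
  have hPb : 8 * (m * Nat.sqrt m) + 1 ≤ (n + 2) ^ 8 := by
    have h1 : m * Nat.sqrt m ≤ m * m := Nat.mul_le_mul_left m (Nat.sqrt_le_self m)
    have h2 : m * m < (n + 2) ^ 3 * (n + 2) ^ 3 := Nat.mul_lt_mul'' hmn hmn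
    have h4 : (n + 2) ^ 8 = (n + 2) ^ 2 * ((n + 2) ^ 3 * (n + 2) ^ 3) := by ring
    have h5 : 16 ≤ (n + 2) ^ 2 := by nlinarith
    have h6 := Nat.mul_le_mul_right ((n + 2) ^ 3 * (n + 2) ^ 3) h5
    omega
  have hL : (n + 2) ^ 8 ≤ 2 ^ (8 * Nat.clog 2 (n + 2)) := by
    rw [mul_comm, pow_mul]
    exact Nat.pow_le_pow_left (Nat.le_pow_clog one_lt_two _) 8
  have hn8 : n + 2 ≤ (n + 2) ^ 8 := Nat.le_self_pow (by omega) _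
  have h16 : 16 ≤ (n + 2) ^ 8 :=
    le_trans (by norm_num) (Nat.pow_le_pow_left (show 2 + 2 ≤ n + 2 by omega) 8)
  have hclog : 1 ≤ 8 * Nat.clog 2 (n + 2) := by
    have := Nat.clog_pos one_lt_two (show 1 < n + 2 by omega)
    omega
  obtain ⟨σ, T, hT, hrun, hD, hN⟩ := hS n G m P M _ _ hM hm hm0 hP.ge
    (by omega) (hPb.trans hL) hclog h16 hMb (by omega)
  rw [← pow_mul] at hrun
  obtain ⟨hE, hB, hH, hmem⟩ := hrun.machine (fun a => (hMb a).trans_le hbase) (by omega)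
  refine ⟨hE, hB, T, ?_, hH, fun htri => ?_⟩
  · have hT' : (T : ℝ) ≤ c * (8 * Nat.clog 2 (n + 2)) := by
      exact_mod_cast hT
    calc (T : ℝ) ≤ c * 8 * Nat.clog 2 (n + 2) := by rw [mul_assoc]; exact hT'
      _ ≤ c * 8 * (3 / Real.log 2 * Real.log n) :=
        mul_le_mul_of_nonneg_left (clog_le_log hn) hC
      _ = _ := by ring
  · rw [hmem]
    refine ⟨by rw [hD]; omega, fun v => ?_⟩
    rw [hN, hD, TC_eq, numerator]
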